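/- **Setting.** Let $q$ and $\pi$ be probability measures on a measurable space $\mathbb{X}$ whose diagonal $\{(x,y):x=y\}$ is measurable in $\mathbb{X}\times\mathbb{X}$. Assume that $\pi\ll q$, let $\omega:\mathbb{X}\to[0,\infty)$ be a measurable version of $d\pi/dq$, and assume that $\omega>0$ $q$-almost surely. For $N\ge 1$ and $\mathbf{x}=(x_1,\dots,x_N)\in\mathbb{X}^N$ put $$\hat Z(\mathbf{x})=\frac1N\sum_{n=1}^N\omega(x_n),\qquad \bar q=q^{\otimes N},\qquad \bar\pi(d\mathbf{x})=\frac1N\sum_{k=1}^N\pi(dx_k)\prod_{n\ne k}q(dx_n).$$ Let $P$ be the transition kernel of particle independent Metropolis--Hastings (PIMH) on $\mathbb{X}^N$: from $\mathbf{x}$, draw $\mathbf{x}^\star\sim\bar q$ and an independent $u\sim\mathrm{Uniform}(0,1)$, and move to $\mathbf{x}^\star$ if $u<\min\{1,\hat Z(\mathbf{x}^\star)/\hat Z(\mathbf{x})\}$; otherwise stay at $\mathbf{x}$. Let $|\mu-\nu|_{\mathrm{TV}}=\sup_A(\mu(A)-\nu(A))$, the supremum being over measurable sets. **Lagged coupling.**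 Draw $\mathbf{x}_0,\mathbf{y}_0\sim\bar q$ independently, and let $\mathbf{x}_1$ be the result of one PIMH step from $\mathbf{x}_0$ with proposal $\mathbf{y}_0$. For $t\ge1$, obtain $(\mathbf{x}_{t+1},\mathbf{y}_t)$ from $(\mathbf{x}_t,\mathbf{y}_{t-1})$ by making one PIMH step from each of the two states, with the same fresh proposal $\mathbf{x}^\star\sim\bar q$ and the same fresh uniform $u$. Let $\tau=\inf\{t\ge1:\mathbf{x}_t=\mathbf{y}_{t-1}\}\in\{1,2,\dots\}\cup\{\infty\}$ be the meeting time. **Theorem.** Let $p\ge2$ be a real number with $q(\omega^p)=\int\omega^p\,dq<\infty$. Then for all $N\ge1$ and all integers $t\ge0$, $$|\bar qP^t-\bar\pi|_{\mathrm{TV}}\le\mathbb{E}\left[\max(0,\tau-1-t)\right].$$ Furthermore, there is a constant $C$, independent of $t$ and $N$, such that for all $N\ge1$ and all integers $t\ge0$, $$|\bar qP^t-\bar\pi|_{\mathrm{TV}}\le\frac{C}{\sqrt N\,(1+t)^{p-1}}.$$ -/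

import Mathlib

open MeasureTheory ProbabilityTheory
open scoped NNReal ENNReal

noncomputable section

namespace PIMH

variable {X : Type*} [MeasurableSpace X]

/-- Total variation distance `sup_A (μ(A) - ν(A))` over measurable sets `A`
(used for probability measures only). -/
def tvDist {E : Type*} [MeasurableSpace E] (μ ν : Measure E) : ℝ :=
  ⨆ A : {A : Set E // MeasurableSet A}, (μ.real A.1 - ν.real A.1)

/-- The Uniform(0,1) distribution. -/
def uniform01 : Measure ℝ := volume.restrict (Set.Ioo 0 1)

instance : IsProbabilityMeasure uniform01 :=
  ⟨by simp [uniform01]⟩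

/-- The proposal `q̄ = q ⊗ ⋯ ⊗ q` on `X^N`. -/
def qBar (q : Measure X) (N : ℕ) : Measure (Fin N → X) :=
  Measure.pi fun _ => q

instance (q : Measure X) [IsProbabilityMeasure q] (N : ℕ) : IsProbabilityMeasure (qBar q N) := by
  unfold qBar; infer_instance

/-- The target `π̄` on `X^N`: the uniform mixture over `k` of the law of `N` independent particles,
the `k`-th one drawn from `π` and the others from `q`; in terms of densities,
`π̄(x₁,…,x_N) = ∑ₖ N⁻¹ π(xₖ) ∏_{n ≠ k} q(xₙ)`. -/
def piBar (q π : Measure X) (N : ℕ) : Measure (Fin N → X) :=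
  (N : ℝ≥0∞)⁻¹ • ∑ k : Fin N, Measure.pi (Function.update (fun _ => q) k π)

/-- The average weight `Ẑ(x) = N⁻¹ ∑ₙ ω(xₙ)`. -/
def Zhat (w : X → ℝ≥0) {N : ℕ} (x : Fin N → X) : ℝ :=
  (N : ℝ)⁻¹ * ∑ n, (w (x n) : ℝ)

/-- The acceptance probability `min {1, Ẑ(x⋆) / Ẑ(x)}`. -/
def accept (w : X → ℝ≥0) {N : ℕ} (x x' : Fin N → X) : ℝ :=
  min 1 (Zhat w x' / Zhat w x)

open Classical in
/-- One PIMH step from `x` with the random input `d = (x⋆, u)`, `x⋆` the proposal and `u` the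
uniform variable: the new state is `x⋆` if `u < min {1, Ẑ(x⋆) / Ẑ(x)}` and `x` otherwise. -/
def step (w : X → ℝ≥0) {N : ℕ} (x : Fin N → X) (d : (Fin N → X) × ℝ) : Fin N → X :=
  if d.2 < accept w x d.1 then d.1 else x

/-- The law of the random input `(x⋆, u)` of one step: `x⋆ ∼ q̄` and `u ∼ Uniform(0,1)`,
independent. -/
def drawLaw (q : Measure X) (N : ℕ) : Measure ((Fin N → X) × ℝ) :=
  (qBar q N).prod uniform01

instance (q : Measure X) [IsProbabilityMeasure q] (N : ℕ) :
    IsProbabilityMeasure (drawLaw q N) := by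
  unfold drawLaw; infer_instance

/-- The transition kernel `P` of PIMH: `P(x, ·)` is the law of `step w x (x⋆, u)` with
`(x⋆, u) ∼ drawLaw q N`, see `kernel_apply`. -/
def kernel (q : Measure X) (w : X → ℝ≥0) (N : ℕ) : Kernel (Fin N → X) (Fin N → X) :=
  (Kernel.id ×ₖ Kernel.const (Fin N → X) (drawLaw q N)).map
    (fun z : (Fin N → X) × ((Fin N → X) × ℝ) => step w z.1 z.2)

/-- One step of the common draws coupling: both chains use the same proposal and the same
uniform variable. -/
def coupledStep (w : X → ℝ≥0) {N : ℕ} (z : (Fin N → X) × (Fin N → X)) (d : (Fin N → X) × ℝ) :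
    (Fin N → X) × (Fin N → X) :=
  (step w z.1 d, step w z.2 d)

/-- The random input of the lagged coupling: a sample `s` consists of the state `s.1 = x₀` and of
the sequence `s.2` of draws, where `s.2 0 = (y₀, u)` and, for `t ≥ 1`, `s.2 t` is the pair
(proposal, uniform) used to produce `(x_{t+1}, y_t)` from `(x_t, y_{t-1})`. -/
abbrev Sample (X : Type*) (N : ℕ) : Type _ := (Fin N → X) × (ℕ → (Fin N → X) × ℝ)

/-- The law of the random input: `x₀`, `y₀` and all the later proposals are drawn from `q̄`, all the
uniform variables from Uniform(0,1), and everything is independent. -/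
def sampleLaw (q : Measure X) (N : ℕ) : Measure (Sample X N) :=
  (qBar q N).prod (Measure.infinitePi fun _ : ℕ => drawLaw q N)

/-- `laggedPair w s t = (x_{t+1}, y_t)`. First `x₁` is the result of a PIMH step from `x₀` with
proposal `y₀`; then `(x_{t+1}, y_t)` is obtained from `(x_t, y_{t-1})` by the common draws
coupling. -/
def laggedPair (w : X → ℝ≥0) {N : ℕ} (s : Sample X N) : ℕ → (Fin N → X) × (Fin N → X)
  | 0 => (step w s.1 (s.2 0), (s.2 0).1)
  | t + 1 => coupledStep w (laggedPair w s t) (s.2 (t + 1))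

/-- The leading chain `x₀, x₁, x₂, …`. -/
def chainX (w : X → ℝ≥0) {N : ℕ} (s : Sample X N) : ℕ → (Fin N → X)
  | 0 => s.1
  | t + 1 => (laggedPair w s t).1

/-- The lagged chain `y₀, y₁, y₂, …`. -/
def chainY (w : X → ℝ≥0) {N : ℕ} (s : Sample X N) (t : ℕ) : Fin N → X :=
  (laggedPair w s t).2

/-- The meeting time `τ = inf {t ≥ 1 : x_t = y_{t-1}}`, with `τ = ∞` if the set is empty. -/
def meetingTime (w : X → ℝ≥0) {N : ℕ} (s : Sample X N) : ℕ∞ :=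
  ⨅ (t : ℕ) (_ : 1 ≤ t ∧ chainX w s t = chainY w s (t - 1)), (t : ℕ∞)

theorem measurable_Zhat {w : X → ℝ≥0} (hw : Measurable w) (N : ℕ) :
    Measurable (Zhat w : (Fin N → X) → ℝ) := by
  unfold Zhat; fun_prop

theorem measurable_step {w : X → ℝ≥0} (hw : Measurable w) (N : ℕ) :
    Measurable (fun z : (Fin N → X) × ((Fin N → X) × ℝ) => step w z.1 z.2) := by
  have hZ := measurable_Zhat hw N
  unfold step accept
  refine Measurable.ite (measurableSet_lt (by fun_prop) (by fun_prop)) ?_ ?_ <;> fun_prop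

theorem kernel_apply (q : Measure X) [IsProbabilityMeasure q] {w : X → ℝ≥0} (hw : Measurable w)
    {N : ℕ} (x : Fin N → X) :
    kernel q w N x = (drawLaw q N).map (step w x) := by
  have h := measurable_step hw N
  rw [kernel, Kernel.map_apply _ h, Kernel.prod_apply, Kernel.id_apply, Kernel.const_apply,
    Measure.dirac_prod, Measure.map_map h (by fun_prop)]
  rfl

theorem measurable_laggedPair {w : X → ℝ≥0} (hw : Measurable w) (N : ℕ) (t : ℕ) :
    Measurable (fun s : Sample X N => laggedPair w s t) := by
  have h := measurable_step hw N
  induction t with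
  | zero =>
    exact (h.comp (f := fun s : Sample X N => (s.1, s.2 0)) (by fun_prop)).prodMk (by fun_prop)
  | succ t ih =>
    exact (h.comp (f := fun s : Sample X N => ((laggedPair w s t).1, s.2 (t+1))) (by fun_prop)).prodMk
      (h.comp (f := fun s : Sample X N => ((laggedPair w s t).2, s.2 (t+1))) (by fun_prop))

theorem measurableSet_pair_eq [MeasurableEq X] (N : ℕ) : MeasurableSet {z : (Fin N → X) × (Fin N → X) | z.1 = z.2} := by
  have : {z : (Fin N → X) × (Fin N → X) | z.1 = z.2} = ⋂ i, (fun z => (z.1 i, z.2 i)) ⁻¹' Set.diagonal X := by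
    ext z; simp [funext_iff]
  rw [this]
  exact MeasurableSet.iInter fun i => measurableSet_diagonal.preimage (by fun_prop)

theorem measurable_meetingTime [MeasurableEq X] {w : X → ℝ≥0} (hw : Measurable w) (N : ℕ) :
    Measurable (fun s : Sample X N => (meetingTime w s : ℝ≥0∞)) := by
  unfold meetingTime
  simp only [ENat.toENNReal_iInf]
  refine Measurable.iInf fun t => ?_
  classical
  have hx : ∀ t, Measurable (fun s : Sample X N => chainX w s t) := by
    intro t; cases t with
    | zero => exact measurable_fst
    | succ t => exact (measurable_laggedPair hw N t).fst
  have hS : MeasurableSet {s : Sample X N | 1 ≤ t ∧ chainX w s t = chainY w s (t-1)} := by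
    refine (MeasurableSet.const _).inter ?_
    exact (measurableSet_pair_eq N).preimage ((hx t).prodMk (measurable_laggedPair hw N (t-1)).snd)
  simp_rw [iInf_eq_if]
  exact Measurable.ite hS measurable_const measurable_const

end PIMH

end

noncomputable section

namespace PIMH

/-! ### Holding probability, first-step recursion and the common draws coupling -/

section Dynamics

variable {X : Type*} {N : ℕ}

/-! Write `Z` for `Zhat w`, `h` for the rejection probability `hold q w`, and `G x = Pᵗ(x, A)`. Both
claims follow from the single estimate `|q̄Pᵗ - π̄| ≤ ∫ Z h^(t+1) dq̄`
(`tvDist_le_integral_hold_pow`). As `π̄ = Z·q̄` is invariant and `∫ Z dq̄ = 1`, `q̄Pᵗ(A) - π̄(A) = ∬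
(Z(y) - Z(x)) G(x)`, which antisymmetrises to `∬ (Z(y) - Z(x))₊ (G(x) - G(y))`. If `Z(x) ≤ Z(y)`,
then under common draws an acceptance from `y` is also one from `x`, so `|G(x) - G(y)| ≤ h(y)^t`
(`abs_kernel_pow_sub_le`). Integrating out `x` gives the last factor, because `∫ (Z(y) - Z(x))₊
q̄(dx) = Z(y) h(y)` (`Zhat_mul_hold`).

Meeting time: while the leading chain rejects, the lagged chain has strictly smaller weight, so `P(τ
> j) ≥ ∫ h^j dq̄`. Summing over `j ≥ t + 1` gives `E[(τ - 1 - t)₊] ≥ ∫ h^(t+1) / (1 - h) dq̄`, and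
`Z (1 - h) ≤ 1` makes this at least `∫ Z h^(t+1) dq̄`.

Rate: `1 - h ≥ c / max(Z, 2)` with `c = ∫ min(1, w) dq` free of `N`, so `h^t` is at most a constant
times `(max(Z, 2) / (1 + t))^(p-1)`. It remains to bound `∫ Z h · max(Z, 2)^(p-1)` by `O(N^(-1/2))`.
Where `Z ≤ 2`, `∫ Z h ≤ 2 ∫ (Z - 1)₊` and the second moment suffice; where `Z > 2`, `∫ (Z - 1)₊^p =
O(1/N)` is used, proved by leaving one particle out (`lintegral_excess_rpow_le`). -/

theorem Zhat_nonneg (w : X → ℝ≥0) (x : Fin N → X) : 0 ≤ Zhat w x := by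
  unfold Zhat; positivity

theorem accept_nonneg (w : X → ℝ≥0) (x y : Fin N → X) : 0 ≤ accept w x y :=
  le_min zero_le_one (div_nonneg (Zhat_nonneg w y) (Zhat_nonneg w x))

theorem accept_le_one (w : X → ℝ≥0) (x y : Fin N → X) : accept w x y ≤ 1 := min_le_left _ _

/-- The draws that are rejected from the state `x`. -/
def rejectSet (w : X → ℝ≥0) (x : Fin N → X) : Set ((Fin N → X) × ℝ) :=
  {d | ¬ d.2 < accept w x d.1}

theorem step_of_mem {w : X → ℝ≥0} {x : Fin N → X} {d : (Fin N → X) × ℝ}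
    (h : d ∈ rejectSet w x) : step w x d = x := if_neg h

theorem step_of_notMem {w : X → ℝ≥0} {x : Fin N → X} {d : (Fin N → X) × ℝ}
    (h : d ∉ rejectSet w x) : step w x d = d.1 := if_pos (not_not.mp h)

/-- A rejected proposal has a smaller weight than the current state. -/
theorem Zhat_lt_of_mem_rejectSet {w : X → ℝ≥0} {x : Fin N → X} (hx : 0 < Zhat w x)
    {d : (Fin N → X) × ℝ} (hd : d.2 < 1) (h : d ∈ rejectSet w x) : Zhat w d.1 < Zhat w x := by
  by_contra! hc
  exact h (hd.trans_le (le_min le_rfl ((one_le_div hx).2 hc)))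

theorem accept_le_accept {w : X → ℝ≥0} {x z : Fin N → X} (hx : 0 < Zhat w x)
    (hxz : Zhat w x ≤ Zhat w z) (y : Fin N → X) : accept w z y ≤ accept w x y :=
  min_le_min le_rfl (div_le_div_of_nonneg_left (Zhat_nonneg w y) hx hxz)

variable [MeasurableSpace X]

theorem measurable_accept {w : X → ℝ≥0} (hw : Measurable w) :
    Measurable (fun z : (Fin N → X) × (Fin N → X) => accept w z.1 z.2) := by
  have := measurable_Zhat hw N
  unfold accept; fun_prop

theorem measurable_accept_right {w : X → ℝ≥0} (hw : Measurable w) (x : Fin N → X) :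
    Measurable (accept w x) :=
  (measurable_accept hw).comp (f := fun y => (x, y)) (by fun_prop)

theorem measurable_step_right {w : X → ℝ≥0} (hw : Measurable w) (x : Fin N → X) :
    Measurable (step w x) :=
  (measurable_step hw N).comp (f := fun d => (x, d)) (by fun_prop)

/-- The probability that a PIMH step from `x` rejects its proposal. -/
def hold (q : Measure X) (w : X → ℝ≥0) (x : Fin N → X) : ℝ :=
  (drawLaw q N).real (rejectSet w x)

theorem measurableSet_rejectSet_prod {w : X → ℝ≥0} (hw : Measurable w) :
    MeasurableSet {z : (Fin N → X) × ((Fin N → X) × ℝ) | z.2 ∈ rejectSet w z.1} := by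
  have h : Measurable fun z : (Fin N → X) × ((Fin N → X) × ℝ) => accept w z.1 z.2.1 :=
    (measurable_accept hw).comp (f := fun z : (Fin N → X) × ((Fin N → X) × ℝ) => (z.1, z.2.1))
      (by fun_prop)
  exact (measurableSet_lt (by fun_prop) h).compl

theorem measurableSet_rejectSet {w : X → ℝ≥0} (hw : Measurable w) (x : Fin N → X) :
    MeasurableSet (rejectSet w x) :=
  (measurableSet_rejectSet_prod hw).preimage (f := fun d => (x, d)) (by fun_prop)

theorem measurable_drawLaw_rejectSet (q : Measure X) [IsProbabilityMeasure q] {w : X → ℝ≥0}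
    (hw : Measurable w) :
    Measurable (fun x : Fin N → X => drawLaw q N (rejectSet w x)) :=
  measurable_measure_prodMk_left (measurableSet_rejectSet_prod hw)

theorem measurable_hold (q : Measure X) [IsProbabilityMeasure q] {w : X → ℝ≥0}
    (hw : Measurable w) : Measurable (hold q w : (Fin N → X) → ℝ) :=
  (measurable_drawLaw_rejectSet q hw).ennreal_toReal

theorem hold_nonneg (q : Measure X) (w : X → ℝ≥0) (x : Fin N → X) : 0 ≤ hold q w x :=
  measureReal_nonneg

theorem hold_le_one (q : Measure X) [IsProbabilityMeasure q] (w : X → ℝ≥0) (x : Fin N → X) :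
    hold q w x ≤ 1 := measureReal_le_one

theorem ofReal_hold (q : Measure X) [IsProbabilityMeasure q] (w : X → ℝ≥0) (x : Fin N → X) :
    ENNReal.ofReal (hold q w x) = drawLaw q N (rejectSet w x) :=
  ENNReal.ofReal_toReal (measure_ne_top _ _)

theorem ae_drawLaw (q : Measure X) [IsProbabilityMeasure q] :
    ∀ᵐ d ∂drawLaw q N, 0 < d.2 ∧ d.2 < 1 := by
  have h : ∀ᵐ u ∂uniform01, 0 < u ∧ u < 1 :=
    (ae_restrict_mem measurableSet_Ioo).mono fun u hu => hu
  exact Measure.quasiMeasurePreserving_snd.ae h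

theorem ae_drawLaw_fst (q : Measure X) [IsProbabilityMeasure q] {P : (Fin N → X) → Prop}
    (h : ∀ᵐ y ∂qBar q N, P y) : ∀ᵐ d ∂drawLaw q N, P d.1 :=
  Measure.quasiMeasurePreserving_fst.ae h

theorem ae_Zhat_pos {q : Measure X} [IsProbabilityMeasure q] {w : X → ℝ≥0}
    (hpos : ∀ᵐ x ∂q, 0 < w x) (hN : 1 ≤ N) : ∀ᵐ x ∂qBar q N, 0 < Zhat w x := by
  have h := (measurePreserving_eval (fun _ : Fin N => q) ⟨0, hN⟩).quasiMeasurePreserving.ae hpos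
  filter_upwards [h] with x hx
  have : 0 < ∑ n, (w (x n) : ℝ) :=
    Finset.sum_pos' (fun _ _ => NNReal.coe_nonneg _) ⟨⟨0, hN⟩, Finset.mem_univ _, hx⟩
  unfold Zhat; positivity

theorem measurable_kernel_pow_real (q : Measure X) (w : X → ℝ≥0) (t : ℕ) {A : Set (Fin N → X)}
    (hA : MeasurableSet A) : Measurable fun x => ((kernel q w N ^ t) x).real A :=
  ((kernel q w N ^ t).measurable_coe hA).ennreal_toReal

/-- The `Fact` lets instance search see the measurability without which `Kernel.map` would not be
Markov. -/
instance (q : Measure X) [IsProbabilityMeasure q] {w : X → ℝ≥0} [hw : Fact (Measurable w)] :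
    IsMarkovKernel (kernel q w N) :=
  Kernel.IsMarkovKernel.map _ (measurable_step hw.out N)

instance {E : Type*} [MeasurableSpace E] (κ : Kernel E E) [IsMarkovKernel κ] (t : ℕ) :
    IsMarkovKernel (κ ^ t) := by
  induction t with
  | zero => exact (inferInstance : IsMarkovKernel (Kernel.id : Kernel E E))
  | succ t ih =>
    rw [pow_succ]
    exact (inferInstance : IsMarkovKernel ((κ ^ t) ∘ₖ κ))

/-- First-step analysis; the inductions for the coupling and for invariance both run on it. -/
theorem kernel_pow_succ_real (q : Measure X) [IsProbabilityMeasure q] {w : X → ℝ≥0}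
    (hw : Measurable w) (t : ℕ) (x : Fin N → X) {A : Set (Fin N → X)} (hA : MeasurableSet A) :
    ((kernel q w N ^ (t + 1)) x).real A =
      ∫ d, ((kernel q w N ^ t) (step w x d)).real A ∂drawLaw q N := by
  have : Fact (Measurable w) := ⟨hw⟩
  have hm := measurable_kernel_pow_real q w t hA
  have hs := measurable_step_right hw x
  rw [integral_eq_lintegral_of_nonneg_ae (.of_forall fun _ => measureReal_nonneg)
    (hm.comp hs).aestronglyMeasurable, measureReal_def, add_comm,
    Kernel.pow_add_apply_eq_lintegral _ _ _ _ hA, pow_one, kernel_apply q hw,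
    lintegral_map ((kernel q w N ^ t).measurable_coe hA) hs]
  congr 2 with d
  exact (ENNReal.ofReal_toReal (measure_ne_top _ _)).symm

/-- Under common draws, two PIMH chains can differ after `t` steps only if the chain started from
the state of larger weight has rejected all its proposals. -/
theorem abs_kernel_pow_sub_le {q : Measure X} [IsProbabilityMeasure q] {w : X → ℝ≥0}
    (hw : Measurable w) (hZ : ∀ᵐ x ∂qBar q N, 0 < Zhat w x) {A : Set (Fin N → X)}
    (hA : MeasurableSet A) (t : ℕ) {x z : Fin N → X} (hx : 0 < Zhat w x)
    (hxz : Zhat w x ≤ Zhat w z) :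
    |((kernel q w N ^ t) x).real A - ((kernel q w N ^ t) z).real A| ≤ hold q w z ^ t := by
  have : Fact (Measurable w) := ⟨hw⟩
  -- Only `x` varies: the induction step calls the hypothesis only on draws that `z` rejects, where
  -- `z` stays and `x` either stays or moves to a proposal still lighter than `z`.
  induction t generalizing x with
  | zero =>
    rw [pow_zero (hold q w z), abs_le]
    constructor <;>
    linarith [measureReal_nonneg (μ := (kernel q w N ^ 0) x) (s := A),
      measureReal_le_one (μ := (kernel q w N ^ 0) x) (s := A),
      measureReal_nonneg (μ := (kernel q w N ^ 0) z) (s := A),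
      measureReal_le_one (μ := (kernel q w N ^ 0) z) (s := A)]
  | succ t ih =>
    have hm := measurable_kernel_pow_real q w t hA
    have hint : ∀ y : Fin N → X, Integrable
        (fun d => ((kernel q w N ^ t) (step w y d)).real A) (drawLaw q N) := fun y =>
      Integrable.of_bound (hm.comp (measurable_step_right hw y)).aestronglyMeasurable 1
        (.of_forall fun d => by
          rw [Real.norm_of_nonneg measureReal_nonneg]; exact measureReal_le_one)
    rw [kernel_pow_succ_real q hw t x hA, kernel_pow_succ_real q hw t z hA,
      ← integral_sub (hint x) (hint z)]
    have hR := measurableSet_rejectSet hw z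
    have key : ∀ᵐ d ∂drawLaw q N,
        ‖((kernel q w N ^ t) (step w x d)).real A - ((kernel q w N ^ t) (step w z d)).real A‖ ≤
        (rejectSet w z).indicator (fun _ => hold q w z ^ t) d := by
      filter_upwards [ae_drawLaw q, ae_drawLaw_fst q hZ] with d hd hdZ
      by_cases hz : d ∈ rejectSet w z
      · rw [Set.indicator_of_mem hz, step_of_mem hz, Real.norm_eq_abs]
        have hlt := Zhat_lt_of_mem_rejectSet (hx.trans_le hxz) hd.2 hz
        by_cases hx' : d ∈ rejectSet w x
        · rw [step_of_mem hx']; exact ih hx hxz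
        · rw [step_of_notMem hx']; exact ih hdZ hlt.le
      -- Acceptance from the heavier state forces acceptance from the lighter one, so both chains
      -- land on the same proposal.
      · have hx' : d ∉ rejectSet w x := by
          have h1 : d.2 < accept w z d.1 := not_not.mp hz
          exact not_not.mpr (h1.trans_le (accept_le_accept hx hxz _))
        rw [Set.indicator_of_notMem hz, step_of_notMem hz, step_of_notMem hx']
        simp
    have h1 := norm_integral_le_of_norm_le
      ((integrable_const (hold q w z ^ t)).indicator hR) key
    rw [integral_indicator_const _ hR, smul_eq_mul] at h1
    rw [pow_succ']
    exact h1

theorem integral_uniform01_ite {a : ℝ} (h0 : 0 ≤ a) (h1 : a ≤ 1) (b c : ℝ) [∀ u, Decidable (u < a)] :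
    ∫ u, (if u < a then b else c) ∂uniform01 = a * b + (1 - a) * c := by
  have h : (fun u => if u < a then b else c) =
      fun u => c + (Set.Iio a).indicator (fun _ => b - c) u := by
    ext u
    by_cases hu : u < a <;> simp [hu]
  have hv : uniform01.real (Set.Iio a) = a := by
    rw [uniform01, measureReal_restrict_apply measurableSet_Iio, Set.inter_comm,
      Set.Ioo_inter_Iio, min_eq_right h1]
    simp [h0]
  rw [h, integral_add (integrable_const _)
    ((integrable_const _).indicator measurableSet_Iio), integral_indicator_const _ measurableSet_Iio, hv]
  simp
  ring

theorem integral_step (q : Measure X) [IsProbabilityMeasure q] {w : X → ℝ≥0}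
    (hw : Measurable w) {g : (Fin N → X) → ℝ} (hg : Measurable g) {B : ℝ} (hB : ∀ y, |g y| ≤ B)
    (x : Fin N → X) :
    ∫ d, g (step w x d) ∂drawLaw q N =
      ∫ y, (accept w x y * g y + (1 - accept w x y) * g x) ∂qBar q N := by
  have hint : Integrable (fun d => g (step w x d)) (drawLaw q N) :=
    Integrable.of_bound (hg.comp (measurable_step_right hw x)).aestronglyMeasurable B
      (.of_forall fun d => hB _)
  rw [drawLaw] at hint ⊢
  rw [integral_prod _ hint]
  congr 1 with y
  rw [← integral_uniform01_ite (accept_nonneg w x y) (accept_le_one w x y)]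
  congr 1 with u
  unfold step
  split_ifs <;> rfl

theorem hold_eq_integral (q : Measure X) [IsProbabilityMeasure q] {w : X → ℝ≥0}
    (hw : Measurable w) (x : Fin N → X) :
    hold q w x = ∫ y, (1 - accept w x y) ∂qBar q N := by
  have hR := measurableSet_rejectSet hw x
  have hint : Integrable ((rejectSet w x).indicator fun _ => (1 : ℝ)) (drawLaw q N) :=
    (integrable_const (1 : ℝ)).indicator hR
  have h1 : hold q w x = ∫ d, (rejectSet w x).indicator (fun _ => (1 : ℝ)) d ∂drawLaw q N := by
    rw [integral_indicator_const _ hR, smul_eq_mul, mul_one, hold]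
  rw [h1]
  rw [drawLaw] at hint ⊢
  rw [integral_prod _ hint]
  congr 1 with y
  classical
  have := integral_uniform01_ite (accept_nonneg w x y) (accept_le_one w x y) 0 1
  rw [mul_zero, zero_add, mul_one] at this
  rw [← this]
  congr 1 with u
  by_cases hu : u < accept w x y <;> simp [rejectSet, Set.indicator_apply, hu]

end Dynamics

/-! ### Invariance of the target and the total variation estimate -/

section Target

variable {X : Type*} {N : ℕ}

theorem ofReal_Zhat (w : X → ℝ≥0) (hN : 1 ≤ N) (x : Fin N → X) :
    ENNReal.ofReal (Zhat w x) = (N : ℝ≥0∞)⁻¹ * ∑ n, (w (x n) : ℝ≥0∞) := by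
  have h0 : (0 : ℝ) < N := by exact_mod_cast hN
  rw [Zhat, ENNReal.ofReal_mul (by positivity), ENNReal.ofReal_inv_of_pos h0,
    ENNReal.ofReal_natCast, ENNReal.ofReal_sum_of_nonneg fun _ _ => NNReal.coe_nonneg _]
  simp

/-- Detailed balance: the right side is symmetric in `x` and `y`. No positivity is needed, since
both sides vanish when `Zhat w x = 0`. -/
theorem Zhat_mul_accept (w : X → ℝ≥0) (x y : Fin N → X) :
    Zhat w x * accept w x y = min (Zhat w x) (Zhat w y) := by
  have hx := Zhat_nonneg w x
  rw [accept, mul_min_of_nonneg _ _ hx, mul_one]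
  rcases hx.eq_or_lt with h | h
  · rw [← h, zero_mul, min_self, min_eq_left (Zhat_nonneg w y)]
  · rw [mul_div_cancel₀ _ h.ne']

theorem Zhat_mul_one_sub_accept (w : X → ℝ≥0) (x y : Fin N → X) :
    Zhat w x * (1 - accept w x y) = max 0 (Zhat w x - Zhat w y) := by
  rw [mul_sub, mul_one, Zhat_mul_accept, ← max_sub_sub_left, sub_self]

variable [MeasurableSpace X]

theorem lintegral_eval (q : Measure X) [IsProbabilityMeasure q] {f : X → ℝ≥0∞}
    (hf : Measurable f) (k : Fin N) : ∫⁻ x, f (x k) ∂qBar q N = ∫⁻ y, f y ∂q :=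
  (measurePreserving_eval (fun _ : Fin N => q) k).lintegral_comp hf

theorem lintegral_weight_eq_one {q π : Measure X} [IsProbabilityMeasure q] [IsProbabilityMeasure π]
    {w : X → ℝ≥0} (hac : π ≪ q) (hwπ : (fun x => (w x : ℝ≥0∞)) =ᵐ[q] π.rnDeriv q) :
    ∫⁻ x, (w x : ℝ≥0∞) ∂q = 1 := by
  rw [lintegral_congr_ae hwπ, Measure.lintegral_rnDeriv hac, measure_univ]

theorem withDensity_weight {q π : Measure X} [IsProbabilityMeasure q] [IsProbabilityMeasure π]
    {w : X → ℝ≥0} (hac : π ≪ q) (hwπ : (fun x => (w x : ℝ≥0∞)) =ᵐ[q] π.rnDeriv q) :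
    q.withDensity (fun x => (w x : ℝ≥0∞)) = π := by
  rw [withDensity_congr_ae hwπ, Measure.withDensity_rnDeriv_eq _ _ hac]

theorem lintegral_Zhat {q : Measure X} [IsProbabilityMeasure q] {w : X → ℝ≥0} (hw : Measurable w)
    (h1 : ∫⁻ x, (w x : ℝ≥0∞) ∂q = 1) (hN : 1 ≤ N) :
    ∫⁻ x, ENNReal.ofReal (Zhat w x) ∂qBar q N = 1 := by
  simp_rw [ofReal_Zhat w hN]
  rw [lintegral_const_mul _ (by fun_prop), lintegral_finsetSum _ (fun n _ => by fun_prop)]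
  have : ∀ n : Fin N, ∫⁻ x, (w (x n) : ℝ≥0∞) ∂qBar q N = 1 := fun n =>
    (lintegral_eval q (f := fun y => (w y : ℝ≥0∞)) (by fun_prop) n).trans h1
  simp only [this, Finset.sum_const, Finset.card_univ, Fintype.card_fin, nsmul_eq_mul, mul_one]
  exact ENNReal.inv_mul_cancel (by simp; omega) (by simp)

theorem integrable_Zhat {q : Measure X} [IsProbabilityMeasure q] {w : X → ℝ≥0}
    (hw : Measurable w) (h1 : ∫⁻ x, (w x : ℝ≥0∞) ∂q = 1) (hN : 1 ≤ N) :
    Integrable (Zhat w) (qBar q N) := by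
  refine ⟨(measurable_Zhat hw N).aestronglyMeasurable, ?_⟩
  rw [hasFiniteIntegral_iff_ofReal (.of_forall fun x => Zhat_nonneg w x), lintegral_Zhat hw h1 hN]
  exact ENNReal.one_lt_top

theorem integral_Zhat {q : Measure X} [IsProbabilityMeasure q] {w : X → ℝ≥0}
    (hw : Measurable w) (h1 : ∫⁻ x, (w x : ℝ≥0∞) ∂q = 1) (hN : 1 ≤ N) :
    ∫ x, Zhat w x ∂qBar q N = 1 := by
  rw [integral_eq_lintegral_of_nonneg_ae (.of_forall fun x => Zhat_nonneg w x)
    (measurable_Zhat hw N).aestronglyMeasurable, lintegral_Zhat hw h1 hN, ENNReal.toReal_one]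

/-- On a box the density of the `k`-th coordinate times the indicator is a product of functions of
single coordinates, so independence factorises its integral. -/
theorem pi_update_withDensity {ι : Type*} [Fintype ι] [DecidableEq ι] (q π : Measure X)
    [IsProbabilityMeasure q] [IsProbabilityMeasure π] {f : X → ℝ≥0∞} (hf : Measurable f)
    (hπ : q.withDensity f = π) (k : ι) :
    Measure.pi (Function.update (fun _ => q) k π) =
      (Measure.pi fun _ : ι => q).withDensity (fun x => f (x k)) := by
  have hpm : ∀ i, IsProbabilityMeasure (Function.update (fun _ : ι => q) k π i) := by
    intro i
    by_cases h : i = k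
    · subst h; simpa
    · simpa [h]
  refine Measure.pi_eq fun s hs => ?_
  have hms : MeasurableSet (Set.univ.pi s) := MeasurableSet.univ_pi hs
  rw [withDensity_apply _ hms, ← lintegral_indicator hms]
  set F : ι → X → ℝ≥0∞ := fun i => (s i).indicator (if i = k then f else 1) with hF
  have hFm : ∀ i, Measurable (F i) := fun i => by
    refine Measurable.indicator ?_ (hs i)
    split_ifs
    · exact hf
    · exact measurable_one
  have hprod : ∀ x : ι → X, (Set.univ.pi s).indicator (fun x => f (x k)) x = ∏ i, F i (x i) := by
    intro x
    by_cases hx : x ∈ Set.univ.pi s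
    · rw [Set.indicator_of_mem hx]
      have : ∀ i, F i (x i) = if i = k then f (x i) else 1 := fun i => by
        rw [hF]
        simp only [Set.indicator_of_mem (hx i trivial)]
        split_ifs <;> rfl
      simp [this]
    · rw [Set.indicator_of_notMem hx]
      obtain ⟨i, hi⟩ : ∃ i, x i ∉ s i := by simpa [Set.mem_pi] using hx
      exact (Finset.prod_eq_zero (Finset.mem_univ i) (Set.indicator_of_notMem hi _)).symm
  simp_rw [hprod]
  have hind := iIndepFun_pi (μ := fun _ : ι => q) (X := F) fun i => (hFm i).aemeasurable
  rw [lintegral_prod_eq_prod_lintegral_of_indepFun Finset.univ (fun i (x : ι → X) => F i (x i))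
    hind (fun i => (hFm i).comp (measurable_pi_apply i))]
  refine Finset.prod_congr rfl fun i _ => ?_
  rw [(measurePreserving_eval (fun _ : ι => q) i).lintegral_comp (hFm i), hF]
  simp only
  rw [lintegral_indicator (hs i)]
  by_cases h : i = k
  · subst h
    rw [if_pos rfl, Function.update_self, ← hπ, withDensity_apply _ (hs i)]
  · simp [h]

theorem piBar_eq_withDensity {q π : Measure X} [IsProbabilityMeasure q] [IsProbabilityMeasure π]
    {w : X → ℝ≥0} (hw : Measurable w) (hac : π ≪ q)
    (hwπ : (fun x => (w x : ℝ≥0∞)) =ᵐ[q] π.rnDeriv q) (hN : 1 ≤ N) :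
    piBar q π N = (qBar q N).withDensity fun x => ENNReal.ofReal (Zhat w x) := by
  ext A hA
  have hwm : Measurable fun x => (w x : ℝ≥0∞) := by fun_prop
  rw [piBar, Measure.smul_apply, Measure.finsetSum_apply, withDensity_apply _ hA]
  simp_rw [ofReal_Zhat w hN]
  rw [lintegral_const_mul _ (by fun_prop), lintegral_finsetSum _ (fun n _ => by fun_prop),
    smul_eq_mul]
  congr 1
  refine Finset.sum_congr rfl fun k _ => ?_
  rw [pi_update_withDensity q π hwm (withDensity_weight hac hwπ) k, withDensity_apply _ hA, qBar]

/-- This turns rejection probabilities into mean positive parts of weight differences; every later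
estimate of `Zhat w x * hold q w x` starts here. -/
theorem Zhat_mul_hold (q : Measure X) [IsProbabilityMeasure q] {w : X → ℝ≥0}
    (hw : Measurable w) (x : Fin N → X) :
    Zhat w x * hold q w x = ∫ y, max 0 (Zhat w x - Zhat w y) ∂qBar q N := by
  rw [hold_eq_integral q hw, ← integral_const_mul]
  simp_rw [Zhat_mul_one_sub_accept]

/-- Invariance of the density `Zhat w` under the PIMH step. -/
theorem integral_Zhat_mul_step {q : Measure X} [IsProbabilityMeasure q] {w : X → ℝ≥0}
    (hw : Measurable w) (h1 : ∫⁻ x, (w x : ℝ≥0∞) ∂q = 1) (hN : 1 ≤ N)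
    {g : (Fin N → X) → ℝ} (hg : Measurable g) {B : ℝ} (hB : ∀ y, |g y| ≤ B) :
    ∫ x, Zhat w x * ∫ d, g (step w x d) ∂drawLaw q N ∂qBar q N =
      ∫ x, Zhat w x * g x ∂qBar q N := by
  have hZ := integrable_Zhat hw h1 hN
  have hZm := measurable_Zhat hw N
  have hZ1 : Integrable (fun z : (Fin N → X) × (Fin N → X) => Zhat w z.1)
      ((qBar q N).prod (qBar q N)) := hZ.comp_fst _
  have hmm : Measurable fun z : (Fin N → X) × (Fin N → X) => min (Zhat w z.1) (Zhat w z.2) := by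
    fun_prop
  have hmin : Integrable (fun z : (Fin N → X) × (Fin N → X) => min (Zhat w z.1) (Zhat w z.2))
      ((qBar q N).prod (qBar q N)) :=
    hZ1.mono' hmm.aestronglyMeasurable (.of_forall fun z => by
      rw [Real.norm_of_nonneg (le_min (Zhat_nonneg w _) (Zhat_nonneg w _))]
      exact min_le_left _ _)
  have hi1 : Integrable (fun z : (Fin N → X) × (Fin N → X) =>
      min (Zhat w z.1) (Zhat w z.2) * g z.1) ((qBar q N).prod (qBar q N)) :=
    hmin.mul_bdd (hg.comp measurable_fst).aestronglyMeasurable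
        (.of_forall fun z => hB _)
  have hi2 : Integrable (fun z : (Fin N → X) × (Fin N → X) =>
      min (Zhat w z.1) (Zhat w z.2) * g z.2) ((qBar q N).prod (qBar q N)) :=
    hmin.mul_bdd (hg.comp measurable_snd).aestronglyMeasurable
        (.of_forall fun z => hB _)
  have hi3 : Integrable (fun z : (Fin N → X) × (Fin N → X) => Zhat w z.1 * g z.1)
      ((qBar q N).prod (qBar q N)) :=
    hZ1.mul_bdd (hg.comp measurable_fst).aestronglyMeasurable
        (.of_forall fun z => hB _)
  have hi21 : Integrable (fun z : (Fin N → X) × (Fin N → X) =>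
      min (Zhat w z.1) (Zhat w z.2) * g z.2 - min (Zhat w z.1) (Zhat w z.2) * g z.1)
      ((qBar q N).prod (qBar q N)) := hi2.sub hi1
  -- Reversibility: the mass flowing in and the mass flowing out cancel by the symmetry of `min`.
  have hswap : ∫ z : (Fin N → X) × (Fin N → X), min (Zhat w z.1) (Zhat w z.2) * g z.2
      ∂(qBar q N).prod (qBar q N) = ∫ z : (Fin N → X) × (Fin N → X),
      min (Zhat w z.1) (Zhat w z.2) * g z.1 ∂(qBar q N).prod (qBar q N) := by
    rw [← integral_prod_swap]
    simp_rw [Prod.fst_swap, Prod.snd_swap, min_comm]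
  calc ∫ x, Zhat w x * ∫ d, g (step w x d) ∂drawLaw q N ∂qBar q N
      = ∫ x, ∫ y, (min (Zhat w x) (Zhat w y) * g y - min (Zhat w x) (Zhat w y) * g x
          + Zhat w x * g x) ∂qBar q N ∂qBar q N := by
        congr 1 with x
        rw [integral_step q hw hg hB, ← integral_const_mul]
        congr 1 with y
        rw [← Zhat_mul_accept]
        ring
    _ = ∫ z : (Fin N → X) × (Fin N → X), (min (Zhat w z.1) (Zhat w z.2) * g z.2
          - min (Zhat w z.1) (Zhat w z.2) * g z.1 + Zhat w z.1 * g z.1)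
          ∂(qBar q N).prod (qBar q N) := (integral_prod _ (hi21.add hi3)).symm
    _ = ∫ x, Zhat w x * g x ∂qBar q N := by
        rw [integral_add hi21 hi3, integral_sub hi2 hi1, hswap, sub_self, zero_add,
          integral_fun_fst (fun x => Zhat w x * g x)]
        simp

theorem integral_Zhat_mul_kernel_pow {q π : Measure X} [IsProbabilityMeasure q]
    [IsProbabilityMeasure π] {w : X → ℝ≥0} (hw : Measurable w) (hac : π ≪ q)
    (hwπ : (fun x => (w x : ℝ≥0∞)) =ᵐ[q] π.rnDeriv q) (hN : 1 ≤ N) (t : ℕ)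
    {A : Set (Fin N → X)} (hA : MeasurableSet A) :
    ∫ x, Zhat w x * ((kernel q w N ^ t) x).real A ∂qBar q N = (piBar q π N).real A := by
  have h1 := lintegral_weight_eq_one hac hwπ
  have : Fact (Measurable w) := ⟨hw⟩
  induction t with
  | zero =>
    have h : ∀ x, Zhat w x * ((kernel q w N ^ 0) x).real A = A.indicator (Zhat w) x := by
      intro x
      have : (kernel q w N ^ 0) x = Measure.dirac x := Kernel.id_apply x
      rw [this, measureReal_def, Measure.dirac_apply' _ hA]
      by_cases hx : x ∈ A <;> simp [hx]
    simp_rw [h]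
    rw [integral_indicator hA, piBar_eq_withDensity hw hac hwπ hN, measureReal_def,
      withDensity_apply _ hA, integral_eq_lintegral_of_nonneg_ae
        (.of_forall fun x => Zhat_nonneg w x) (measurable_Zhat hw N).aestronglyMeasurable]
  | succ t ih =>
    simp_rw [kernel_pow_succ_real q hw t _ hA]
    rw [integral_Zhat_mul_step hw h1 hN (measurable_kernel_pow_real q w t hA) (B := 1), ih]
    intro y
    rw [abs_of_nonneg measureReal_nonneg]
    exact measureReal_le_one

theorem comp_real_eq_integral (q : Measure X) [IsProbabilityMeasure q] {w : X → ℝ≥0}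
    (hw : Measurable w) (t : ℕ) {A : Set (Fin N → X)} (hA : MeasurableSet A) :
    ((kernel q w N ^ t : Kernel (Fin N → X) (Fin N → X)) ∘ₘ qBar q N).real A =
      ∫ x, ((kernel q w N ^ t) x).real A ∂qBar q N := by
  have : Fact (Measurable w) := ⟨hw⟩
  rw [integral_eq_lintegral_of_nonneg_ae (.of_forall fun _ => measureReal_nonneg)
    (measurable_kernel_pow_real q w t hA).aestronglyMeasurable, measureReal_def,
    Measure.bind_apply hA (Kernel.aemeasurable _)]
  congr 2 with d
  exact (ENNReal.ofReal_toReal (measure_ne_top _ _)).symm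

theorem integrable_Zhat_mul_hold_pow {q : Measure X} [IsProbabilityMeasure q] {w : X → ℝ≥0}
    (hw : Measurable w) (h1 : ∫⁻ x, (w x : ℝ≥0∞) ∂q = 1) (hN : 1 ≤ N) (t : ℕ) :
    Integrable (fun x : Fin N → X => Zhat w x * hold q w x ^ t) (qBar q N) :=
  (integrable_Zhat hw h1 hN).mul_bdd ((measurable_hold q hw).pow_const t).aestronglyMeasurable
    (.of_forall fun x => by
      rw [Real.norm_of_nonneg (pow_nonneg (hold_nonneg q w x) t)]
      exact pow_le_one₀ (hold_nonneg q w x) (hold_le_one q w x))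

/-- The total variation distance to the target is at most the `π̄`-expectation of the `(t+1)`-th
power of the holding probability. -/
theorem tvDist_le_integral_hold_pow {q π : Measure X} [IsProbabilityMeasure q]
    [IsProbabilityMeasure π] {w : X → ℝ≥0} (hw : Measurable w) (hac : π ≪ q)
    (hwπ : (fun x => (w x : ℝ≥0∞)) =ᵐ[q] π.rnDeriv q) (hpos : ∀ᵐ x ∂q, 0 < w x)
    (hN : 1 ≤ N) (t : ℕ) :
    tvDist ((kernel q w N ^ t : Kernel (Fin N → X) (Fin N → X)) ∘ₘ qBar q N) (piBar q π N) ≤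
      ∫ x, Zhat w x * hold q w x ^ (t + 1) ∂qBar q N := by
  have h1 := lintegral_weight_eq_one hac hwπ
  have hFact : Fact (Measurable w) := ⟨hw⟩
  have hZpos := ae_Zhat_pos (N := N) hpos hN
  have : Nonempty {A : Set (Fin N → X) // MeasurableSet A} := ⟨⟨∅, MeasurableSet.empty⟩⟩
  refine ciSup_le fun ⟨A, hA⟩ => ?_
  simp only
  rw [comp_real_eq_integral q hw t hA, ← integral_Zhat_mul_kernel_pow hw hac hwπ hN t hA]
  set Q := qBar q N
  set G : (Fin N → X) → ℝ := fun x => ((kernel q w N ^ t) x).real A with hG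
  have hGm : Measurable G := measurable_kernel_pow_real q w t hA
  have hGb : ∀ x, ‖G x‖ ≤ 1 := fun x => by
    rw [Real.norm_of_nonneg measureReal_nonneg]; exact measureReal_le_one
  have hZm := measurable_Zhat hw N
  have hZ := integrable_Zhat hw h1 hN
  have hh := measurable_hold (N := N) q hw
  have hZ1 : Integrable (fun z : (Fin N → X) × (Fin N → X) => Zhat w z.1) (Q.prod Q) :=
    hZ.comp_fst _
  have hZ2 : Integrable (fun z : (Fin N → X) × (Fin N → X) => Zhat w z.2) (Q.prod Q) :=
    hZ.comp_snd _
  have hD : Integrable (fun z : (Fin N → X) × (Fin N → X) => max 0 (Zhat w z.2 - Zhat w z.1))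
      (Q.prod Q) := by
    have := (hZ2.sub hZ1).pos_part
    refine this.congr (.of_forall fun z => ?_)
    simp [max_comm]
  have hi1 : Integrable (fun z : (Fin N → X) × (Fin N → X) =>
      max 0 (Zhat w z.2 - Zhat w z.1) * G z.1) (Q.prod Q) :=
    hD.mul_bdd (hGm.comp measurable_fst).aestronglyMeasurable
        (.of_forall fun z => hGb _)
  have hi2 : Integrable (fun z : (Fin N → X) × (Fin N → X) =>
      max 0 (Zhat w z.2 - Zhat w z.1) * G z.2) (Q.prod Q) :=
    hD.mul_bdd (hGm.comp measurable_snd).aestronglyMeasurable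
        (.of_forall fun z => hGb _)
  have hi1' : Integrable (fun z : (Fin N → X) × (Fin N → X) =>
      max 0 (Zhat w z.1 - Zhat w z.2) * G z.1) (Q.prod Q) := hi2.swap
  have hi3 : Integrable (fun z : (Fin N → X) × (Fin N → X) =>
      max 0 (Zhat w z.2 - Zhat w z.1) * hold q w z.2 ^ t) (Q.prod Q) :=
    hD.mul_bdd ((hh.comp measurable_snd).pow_const t).aestronglyMeasurable
        (.of_forall fun z => by
      rw [Real.norm_of_nonneg (pow_nonneg (hold_nonneg q w _) t)]
      exact pow_le_one₀ (hold_nonneg q w _) (hold_le_one q w _))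
  -- The constant `1` in `∫ (1 - Zhat) G` is replaced by the mean of an independent copy of `Zhat`.
  have e1 : ∫ z : (Fin N → X) × (Fin N → X), (Zhat w z.2 - Zhat w z.1) * G z.1 ∂Q.prod Q =
      ∫ x, G x ∂Q - ∫ x, Zhat w x * G x ∂Q := by
    have ha : Integrable (fun z : (Fin N → X) × (Fin N → X) => G z.1 * Zhat w z.2) (Q.prod Q) :=
      hZ2.bdd_mul (hGm.comp measurable_fst).aestronglyMeasurable
        (.of_forall fun z => hGb _)
    have hb : Integrable (fun z : (Fin N → X) × (Fin N → X) => Zhat w z.1 * G z.1) (Q.prod Q) :=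
      hZ1.mul_bdd (hGm.comp measurable_fst).aestronglyMeasurable
        (.of_forall fun z => hGb _)
    have : ∀ z : (Fin N → X) × (Fin N → X), (Zhat w z.2 - Zhat w z.1) * G z.1 =
      G z.1 * Zhat w z.2 - Zhat w z.1 * G z.1 := fun z => by ring
    simp_rw [this]
    rw [integral_sub ha hb, integral_prod_mul, integral_Zhat hw h1 hN, mul_one,
      integral_fun_fst (fun x => Zhat w x * G x)]
    simp
  have e2 : ∫ z : (Fin N → X) × (Fin N → X), max 0 (Zhat w z.1 - Zhat w z.2) * G z.1 ∂Q.prod Q =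
      ∫ z : (Fin N → X) × (Fin N → X), max 0 (Zhat w z.2 - Zhat w z.1) * G z.2 ∂Q.prod Q := by
    rw [← integral_prod_swap]
    rfl
  -- Integrating out the lighter state raises the exponent from `t` to `t + 1`.
  have e3 : ∫ z : (Fin N → X) × (Fin N → X), max 0 (Zhat w z.2 - Zhat w z.1) * hold q w z.2 ^ t
      ∂Q.prod Q = ∫ x, Zhat w x * hold q w x ^ (t + 1) ∂Q := by
    rw [integral_prod_symm _ hi3]
    congr 1 with x
    simp only
    rw [integral_mul_const, ← Zhat_mul_hold q hw, pow_succ]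
    ring
  have hsub : ∫ x, (G x - Zhat w x * G x) ∂Q = ∫ x, G x ∂Q - ∫ x, Zhat w x * G x ∂Q :=
    integral_sub (.of_bound hGm.aestronglyMeasurable 1 (.of_forall hGb))
      (hZ.mul_bdd hGm.aestronglyMeasurable (.of_forall hGb))
  rw [← e1, ← e3]
  -- Positive minus negative part; swapping variables in the negative part (`e2`) leaves a
  -- difference of `G` at two states, to which the coupling bound applies.
  have hsplit : ∀ z : (Fin N → X) × (Fin N → X), (Zhat w z.2 - Zhat w z.1) * G z.1 =
      max 0 (Zhat w z.2 - Zhat w z.1) * G z.1 - max 0 (Zhat w z.1 - Zhat w z.2) * G z.1 := by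
    intro z
    rw [← sub_mul]
    congr 1
    rcases le_total (Zhat w z.1) (Zhat w z.2) with h | h
    · rw [max_eq_right (by linarith), max_eq_left (by linarith)]; ring
    · rw [max_eq_left (by linarith), max_eq_right (by linarith)]; ring
  simp_rw [hsplit]
  rw [integral_sub hi1 hi1', e2, ← integral_sub hi1 hi2]
  refine integral_mono_ae (hi1.sub hi2) hi3 ?_
  have hp1 : ∀ᵐ z ∂Q.prod Q, 0 < Zhat w z.1 := Measure.quasiMeasurePreserving_fst.ae hZpos
  filter_upwards [hp1] with z hz
  rw [← mul_sub]
  rcases le_total (Zhat w z.2) (Zhat w z.1) with h | h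
  · rw [max_eq_left (by linarith), zero_mul, zero_mul]
  · exact mul_le_mul_of_nonneg_left
      ((le_abs_self _).trans (abs_kernel_pow_sub_le hw hZpos hA t hz h)) (le_max_left _ _)

end Target

/-! ### Tail of the meeting time and the first bound -/

section Meeting

variable {X : Type*} {N : ℕ}

/-- The samples whose first `j` draws are all rejected from the initial state. -/
def rejectRun (w : X → ℝ≥0) (N j : ℕ) : Set (Sample X N) :=
  {s | ∀ i < j, s.2 i ∈ rejectSet w s.1}

/-- As long as the leading chain does not move, the lagged chain has a smaller weight. -/
theorem laggedPair_of_mem_rejectRun {w : X → ℝ≥0} {s : Sample X N} (hs : 0 < Zhat w s.1)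
    (hu : ∀ i, (s.2 i).2 < 1) {j : ℕ} (h : s ∈ rejectRun w N j) (k : ℕ) (hk : k < j) :
    (laggedPair w s k).1 = s.1 ∧ Zhat w (laggedPair w s k).2 < Zhat w s.1 := by
  induction k with
  | zero => exact ⟨step_of_mem (h 0 hk), Zhat_lt_of_mem_rejectSet hs (hu 0) (h 0 hk)⟩
  | succ k ih =>
    obtain ⟨ih1, ih2⟩ := ih (by omega)
    have hlt := Zhat_lt_of_mem_rejectSet hs (hu (k + 1)) (h (k + 1) hk)
    simp only [laggedPair, coupledStep, ih1]
    refine ⟨step_of_mem (h (k + 1) hk), ?_⟩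
    by_cases hy : s.2 (k + 1) ∈ rejectSet w (laggedPair w s k).2
    · rwa [step_of_mem hy]
    · rwa [step_of_notMem hy]

/-- Draws `0, …, j - 1` determine the states up to time `j` of the leading chain, and the strict gap
in weight excludes a meeting at each of the times `1, …, j`. -/
theorem lt_meetingTime_of_mem_rejectRun {w : X → ℝ≥0} {s : Sample X N} (hs : 0 < Zhat w s.1)
    (hu : ∀ i, (s.2 i).2 < 1) {j : ℕ} (h : s ∈ rejectRun w N j) :
    (j : ℕ∞) < meetingTime w s := by
  have hle : ((j + 1 : ℕ) : ℕ∞) ≤ meetingTime w s := by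
    refine le_iInf₂ fun t ht => ?_
    by_contra! hlt
    have hlt' : t < j + 1 := by exact_mod_cast hlt
    obtain ⟨k, rfl⟩ : ∃ k, t = k + 1 := ⟨t - 1, by omega⟩
    obtain ⟨h1, h2⟩ := laggedPair_of_mem_rejectRun hs hu h k (by omega)
    have h3 : (laggedPair w s k).1 = (laggedPair w s k).2 := ht.2
    rw [← h3, h1] at h2
    exact lt_irrefl _ h2
  exact lt_of_lt_of_le (by exact_mod_cast Nat.lt_succ_self j) hle

/-- The sum counts the integers `j` with `t + 1 ≤ j < m`; the truncated subtraction in `ℝ≥0∞`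
already supplies the positive part. -/
theorem tsum_lt_indicator_le (t : ℕ) (m : ℕ∞) :
    ∑' i : ℕ, (if ((t + 1 + i : ℕ) : ℕ∞) < m then (1 : ℝ≥0∞) else 0) ≤
      (m : ℝ≥0∞) - 1 - (t : ℝ≥0∞) := by
  rw [ENNReal.tsum_eq_iSup_nat]
  refine iSup_le fun n => ?_
  induction m using ENat.recTopCoe with
  | top => simp [ENNReal.top_sub]
  | coe m =>
    simp only [Nat.cast_lt, ENat.toENNReal_coe]
    have hm : (m : ℝ≥0∞) - 1 - t = ((m - 1 - t : ℕ) : ℝ≥0∞) := by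
      rw [ENNReal.natCast_sub, ENNReal.natCast_sub, Nat.cast_one]
    rw [hm, Finset.sum_boole]
    refine Nat.cast_le.2 ?_
    calc _ ≤ (Finset.range (m - 1 - t)).card := Finset.card_le_card fun i hi => by
          simp only [Finset.mem_filter, Finset.mem_range] at hi ⊢
          omega
      _ = m - 1 - t := Finset.card_range _

variable [MeasurableSpace X]

theorem measurableSet_rejectRun {w : X → ℝ≥0} (hw : Measurable w) (j : ℕ) :
    MeasurableSet (rejectRun w N j) := by
  have : rejectRun w N j = ⋂ i : ℕ, ⋂ _ : i < j, (fun s : Sample X N => (s.1, s.2 i)) ⁻¹'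
      {z : (Fin N → X) × ((Fin N → X) × ℝ) | z.2 ∈ rejectSet w z.1} := by
    ext s; simp [rejectRun]
  rw [this]
  exact MeasurableSet.iInter fun i => MeasurableSet.iInter fun _ =>
    (measurableSet_rejectSet_prod hw).preimage (by fun_prop)

/-- Given the initial state, the run is a cylinder set of independent identically distributed draws.
-/
theorem sampleLaw_rejectRun (q : Measure X) [IsProbabilityMeasure q] {w : X → ℝ≥0}
    (hw : Measurable w) (j : ℕ) :
    sampleLaw q N (rejectRun w N j) = ∫⁻ x, drawLaw q N (rejectSet w x) ^ j ∂qBar q N := by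
  rw [sampleLaw, Measure.prod_apply (measurableSet_rejectRun hw j)]
  congr 1 with x
  have : Prod.mk x ⁻¹' rejectRun w N j =
      Set.pi (Finset.range j : Set ℕ) (fun _ => rejectSet w x) := by
    ext d; simp [rejectRun, Set.mem_pi]
  rw [this, Measure.infinitePi_pi _ fun _ _ => measurableSet_rejectSet hw x]
  simp

theorem ae_sampleLaw {q : Measure X} [IsProbabilityMeasure q] {w : X → ℝ≥0}
    (hpos : ∀ᵐ x ∂q, 0 < w x) (hN : 1 ≤ N) :
    ∀ᵐ s ∂sampleLaw q N, 0 < Zhat w s.1 ∧ ∀ i, (s.2 i).2 < 1 := by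
  have h1 : ∀ᵐ s ∂sampleLaw q N, 0 < Zhat w s.1 :=
    Measure.quasiMeasurePreserving_fst.ae (ae_Zhat_pos hpos hN)
  have h2 : ∀ᵐ d ∂Measure.infinitePi fun _ : ℕ => drawLaw q N, ∀ i, (d i).2 < 1 :=
    ae_all_iff.2 fun i => (measurePreserving_eval_infinitePi (fun _ : ℕ => drawLaw q N)
      i).quasiMeasurePreserving.ae ((ae_drawLaw q).mono fun d hd => hd.2)
  have h3 : ∀ᵐ s ∂sampleLaw q N, ∀ i, (s.2 i).2 < 1 := Measure.quasiMeasurePreserving_snd.ae h2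
  exact h1.and h3

/-- The mean excess of the meeting time dominates the expected residual of the geometric series
of holding probabilities. -/
theorem lintegral_hold_series_le {q : Measure X} [IsProbabilityMeasure q] {w : X → ℝ≥0}
    (hw : Measurable w) (hpos : ∀ᵐ x ∂q, 0 < w x) (hN : 1 ≤ N) (t : ℕ) :
    ∫⁻ x, drawLaw q N (rejectSet w x) ^ (t + 1) * (1 - drawLaw q N (rejectSet w x))⁻¹ ∂qBar q N ≤
      ∫⁻ s, ((meetingTime w s : ℝ≥0∞) - 1 - (t : ℝ≥0∞)) ∂sampleLaw q N := by
  have hm := measurable_drawLaw_rejectSet (N := N) q hw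
  calc _ = ∫⁻ x, ∑' i : ℕ, drawLaw q N (rejectSet w x) ^ (t + 1 + i) ∂qBar q N := by
        congr 1 with x
        simp_rw [pow_add _ (t + 1)]
        rw [ENNReal.tsum_mul_left, ENNReal.tsum_geometric]
    _ = ∑' i : ℕ, ∫⁻ s, (rejectRun w N (t + 1 + i)).indicator 1 s ∂sampleLaw q N := by
        rw [lintegral_tsum fun i => (hm.pow_const _).aemeasurable]
        congr 1 with i
        rw [lintegral_indicator_one (measurableSet_rejectRun hw _), sampleLaw_rejectRun q hw]
    _ = ∫⁻ s, ∑' i : ℕ, (rejectRun w N (t + 1 + i)).indicator 1 s ∂sampleLaw q N :=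
        (lintegral_tsum fun i =>
          (measurable_one.indicator (measurableSet_rejectRun hw _)).aemeasurable).symm
    _ ≤ _ := by
        refine lintegral_mono_ae ?_
        filter_upwards [ae_sampleLaw hpos hN] with s hs
        refine le_trans (ENNReal.tsum_le_tsum fun i => ?_) (tsum_lt_indicator_le t _)
        by_cases h : s ∈ rejectRun w N (t + 1 + i)
        · rw [if_pos (lt_meetingTime_of_mem_rejectRun hs.1 hs.2 h), Set.indicator_of_mem h]
          rfl
        · rw [Set.indicator_of_notMem h]
          exact zero_le

/-- The left side is the mean of `min (Zhat w x) (Zhat w y)` over `y`, hence at most the mean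
weight. The proof uses the equivalent lower bound of a positive part by the difference itself. -/
theorem Zhat_mul_one_sub_hold_le {q : Measure X} [IsProbabilityMeasure q] {w : X → ℝ≥0}
    (hw : Measurable w) (h1 : ∫⁻ x, (w x : ℝ≥0∞) ∂q = 1) (hN : 1 ≤ N) (x : Fin N → X) :
    Zhat w x * (1 - hold q w x) ≤ 1 := by
  have hZ := integrable_Zhat hw h1 hN
  have hZm := measurable_Zhat hw N
  have hi : Integrable (fun y => max 0 (Zhat w x - Zhat w y)) (qBar q N) :=
    ((integrable_const (Zhat w x)).sub hZ).pos_part.congr (.of_forall fun z => by simp [max_comm])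
  have hd : Integrable (fun y => Zhat w x - Zhat w y) (qBar q N) :=
    (integrable_const (Zhat w x)).sub hZ
  have h : Zhat w x - 1 ≤ Zhat w x * hold q w x := by
    rw [Zhat_mul_hold q hw]
    calc Zhat w x - 1 = ∫ y, (Zhat w x - Zhat w y) ∂qBar q N := by
          rw [integral_sub (integrable_const _) hZ, integral_Zhat hw h1 hN]; simp
      _ ≤ _ := integral_mono hd hi fun y => le_max_right _ _
  linarith

theorem ofReal_Zhat_le_inv_one_sub {q : Measure X} [IsProbabilityMeasure q] {w : X → ℝ≥0}
    (hw : Measurable w) (h1 : ∫⁻ x, (w x : ℝ≥0∞) ∂q = 1) (hN : 1 ≤ N) (x : Fin N → X) :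
    ENNReal.ofReal (Zhat w x) ≤ (1 - drawLaw q N (rejectSet w x))⁻¹ := by
  have h := Zhat_mul_one_sub_hold_le hw h1 hN x
  rw [ENNReal.le_inv_iff_mul_le, ← ofReal_hold, ← ENNReal.ofReal_one,
    ← ENNReal.ofReal_sub _ (hold_nonneg q w x), ← ENNReal.ofReal_mul (Zhat_nonneg w x)]
  exact ENNReal.ofReal_le_ofReal h

theorem tvDist_le_lintegral_meetingTime {q π : Measure X} [IsProbabilityMeasure q]
    [IsProbabilityMeasure π] {w : X → ℝ≥0} (hw : Measurable w) (hac : π ≪ q)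
    (hwπ : (fun x => (w x : ℝ≥0∞)) =ᵐ[q] π.rnDeriv q) (hpos : ∀ᵐ x ∂q, 0 < w x)
    (hN : 1 ≤ N) (t : ℕ) :
    ENNReal.ofReal (tvDist ((kernel q w N ^ t : Kernel (Fin N → X) (Fin N → X)) ∘ₘ qBar q N)
      (piBar q π N)) ≤
      ∫⁻ s, max 0 ((meetingTime w s : ℝ≥0∞) - 1 - (t : ℝ≥0∞)) ∂sampleLaw q N := by
  have h1 := lintegral_weight_eq_one hac hwπ
  have hnn : ∀ x : Fin N → X, 0 ≤ Zhat w x * hold q w x ^ (t + 1) := fun x =>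
    mul_nonneg (Zhat_nonneg w x) (pow_nonneg (hold_nonneg q w x) _)
  calc _ ≤ ENNReal.ofReal (∫ x, Zhat w x * hold q w x ^ (t + 1) ∂qBar q N) :=
        ENNReal.ofReal_le_ofReal (tvDist_le_integral_hold_pow hw hac hwπ hpos hN t)
    _ = ∫⁻ x, ENNReal.ofReal (Zhat w x * hold q w x ^ (t + 1)) ∂qBar q N :=
        ofReal_integral_eq_lintegral_ofReal (integrable_Zhat_mul_hold_pow hw h1 hN _)
          (.of_forall hnn)
    _ ≤ ∫⁻ x, drawLaw q N (rejectSet w x) ^ (t + 1) * (1 - drawLaw q N (rejectSet w x))⁻¹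
          ∂qBar q N := by
        refine lintegral_mono fun x => ?_
        rw [ENNReal.ofReal_mul (Zhat_nonneg w x), ENNReal.ofReal_pow (hold_nonneg q w x),
          ofReal_hold, mul_comm]
        exact mul_le_mul_right (ofReal_Zhat_le_inv_one_sub hw h1 hN x) _
    _ ≤ ∫⁻ s, ((meetingTime w s : ℝ≥0∞) - 1 - (t : ℝ≥0∞)) ∂sampleLaw q N :=
        lintegral_hold_series_le hw hpos hN t
    _ = _ := by
        congr 1 with s
        exact (max_eq_right zero_le).symm

end Meeting

/-! ### Moments of the excess weight by leaving one particle out -/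

section Moments

/-- A mean value bound for the convex function `max 0 (· - 1) ^ (p - 1)`, used to remove one
particle from the average. -/
theorem excess_rpow_add_le {p : ℝ} (hp : 2 ≤ p) {s h : ℝ} (hs : 0 ≤ s) (hh : 0 ≤ h) :
    max 0 (s + h - 1) ^ (p - 1) ≤
      max 0 (s - 1) ^ (p - 1) + (p - 1) * h * (s + h) ^ (p - 2) := by
  have hrest : 0 ≤ (p - 1) * h * (s + h) ^ (p - 2) :=
    mul_nonneg (mul_nonneg (by linarith) hh) (Real.rpow_nonneg (by linarith) _)
  have ha : 0 ≤ max 0 (s - 1) := le_max_left _ _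
  rcases le_or_gt (s + h - 1) 0 with hb | hb
  · rw [max_eq_left hb, Real.zero_rpow (by linarith)]
    have := Real.rpow_nonneg ha (p - 1)
    linarith
  · rw [max_eq_right hb.le]
    set b := s + h - 1 with hbdef
    set a := max 0 (s - 1) with hadef
    have hba : b - a ≤ h := by
      have : s - 1 ≤ a := le_max_right _ _
      linarith
    have hab : a ≤ b := max_le hb.le (by linarith)
    -- Bernoulli's inequality at `a / b`, multiplied by `b ^ (p - 1)`, is the tangent line bound at
    -- `b`.
    have bern := one_add_mul_self_le_rpow_one_add (s := a / b - 1) (p := p - 1)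
      (by have := div_nonneg ha hb.le; linarith) (by linarith)
    rw [add_sub_cancel, Real.div_rpow ha hb.le] at bern
    have hbp : 0 < b ^ (p - 1) := Real.rpow_pos_of_pos hb _
    have hsplit : b ^ (p - 1) = b ^ (p - 2) * b := by
      rw [← Real.rpow_add_one hb.ne']; congr 1; ring
    have h1 : b ^ (p - 1) - (p - 1) * (b - a) * b ^ (p - 2) ≤ a ^ (p - 1) := by
      rw [le_div_iff₀ hbp] at bern
      refine le_trans (le_of_eq ?_) bern
      rw [hsplit]
      field_simp
      ring
    have h2 : (p - 1) * (b - a) * b ^ (p - 2) ≤ (p - 1) * h * (s + h) ^ (p - 2) := by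
      refine mul_le_mul (mul_le_mul_of_nonneg_left hba (by linarith))
        (Real.rpow_le_rpow hb.le (by linarith) (by linarith)) (Real.rpow_nonneg hb.le _)
        (mul_nonneg (by linarith) hh)
    linarith

theorem sq_mul_rpow_le {p : ℝ} (hp : 2 ≤ p) {a b : ℝ} (ha : 0 ≤ a) (hb : 0 ≤ b) :
    a * (a * b ^ (p - 2)) ≤ a ^ p + b ^ p := by
  have hm : 0 ≤ max a b := ha.trans (le_max_left _ _)
  have h1 : a * (a * b ^ (p - 2)) ≤ max a b ^ p := by
    calc a * (a * b ^ (p - 2)) ≤ max a b * (max a b * max a b ^ (p - 2)) := by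
          gcongr
          · exact le_max_left _ _
          · exact le_max_left _ _
          · exact le_max_right _ _
      _ = max a b ^ p := by
          rw [← mul_assoc, ← sq, ← Real.rpow_natCast, ← Real.rpow_add_of_nonneg hm (by norm_num)
            (by linarith)]
          congr 1; push_cast; ring
  refine h1.trans ?_
  have := Real.rpow_nonneg ha p
  have := Real.rpow_nonneg hb p
  rcases max_cases a b with ⟨h, -⟩ | ⟨h, -⟩ <;> rw [h] <;> linarith

variable {X : Type*} {N : ℕ}

theorem Zhat_rpow_le (w : X → ℝ≥0) (hN : 1 ≤ N) {p : ℝ} (hp : 1 ≤ p) (x : Fin N → X) :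
    Zhat w x ^ p ≤ (N : ℝ)⁻¹ * ∑ n, (w (x n) : ℝ) ^ p := by
  have h0 : (N : ℝ) ≠ 0 := by positivity
  rw [Zhat, Finset.mul_sum, Finset.mul_sum]
  exact Real.rpow_arith_mean_le_arith_mean_rpow Finset.univ (fun _ => (N : ℝ)⁻¹)
    (fun n => (w (x n) : ℝ)) (fun _ _ => by positivity) (by simp [h0])
    (fun _ _ => NNReal.coe_nonneg _) hp

/-- The left side equals `Zhat * max 0 (Zhat - 1) ^ (p - 1)`. Expand the first factor as an average
and, in the `k`-th term, drop particle `k` from the second; each removal costs a factor `1 / N`. The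
extra `(p - 1)`-th power on the left will cancel after integration. -/
theorem excess_rpow_add_excess_rpow_le (w : X → ℝ≥0) (hN : 1 ≤ N) {p : ℝ} (hp : 2 ≤ p)
    (x : Fin N → X) :
    max 0 (Zhat w x - 1) ^ (p - 1) + max 0 (Zhat w x - 1) ^ p ≤
      (N : ℝ)⁻¹ * ∑ k, (w (x k) : ℝ) *
        max 0 ((N : ℝ)⁻¹ * (∑ i ∈ Finset.univ.erase k, (w (x i) : ℝ)) - 1) ^ (p - 1) +
      2 * (p - 1) / N * ((N : ℝ)⁻¹ * ∑ n, (w (x n) : ℝ) ^ p) := by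
  have hN0 : (0 : ℝ) < N := by exact_mod_cast hN
  have hZ0 := Zhat_nonneg w x
  have hJ := Zhat_rpow_le w hN (p := p) (by linarith) x
  set W := Zhat w x with hW
  have hleft : max 0 (W - 1) ^ (p - 1) + max 0 (W - 1) ^ p = W * max 0 (W - 1) ^ (p - 1) := by
    rcases le_or_gt W 1 with h | h
    · rw [max_eq_left (by linarith), Real.zero_rpow (by linarith), Real.zero_rpow (by linarith)]
      ring
    · rw [max_eq_right (by linarith)]
      have : (W - 1) ^ p = (W - 1) ^ (p - 1) * (W - 1) := by
        rw [← Real.rpow_add_one (by linarith)]; congr 1; ring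
      rw [this]; ring
  have hk : ∀ k : Fin N, (w (x k) : ℝ) * max 0 (W - 1) ^ (p - 1) ≤
      (w (x k) : ℝ) *
        max 0 ((N : ℝ)⁻¹ * (∑ i ∈ Finset.univ.erase k, (w (x i) : ℝ)) - 1) ^ (p - 1) +
      (p - 1) / N * ((w (x k) : ℝ) ^ p + W ^ p) := by
    intro k
    have hwk : (0 : ℝ) ≤ w (x k) := NNReal.coe_nonneg _
    have hs : 0 ≤ (N : ℝ)⁻¹ * ∑ i ∈ Finset.univ.erase k, (w (x i) : ℝ) := by positivity
    have hsum : W = (N : ℝ)⁻¹ * (∑ i ∈ Finset.univ.erase k, (w (x i) : ℝ)) +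
        (N : ℝ)⁻¹ * w (x k) := by
      rw [hW, Zhat, ← mul_add, Finset.sum_erase_add _ _ (Finset.mem_univ k)]
    have h1 := excess_rpow_add_le hp hs (h := (N : ℝ)⁻¹ * w (x k)) (by positivity)
    rw [← hsum] at h1
    have h2 := sq_mul_rpow_le hp hwk hZ0
    calc _ ≤ (w (x k) : ℝ) *
        (max 0 ((N : ℝ)⁻¹ * (∑ i ∈ Finset.univ.erase k, (w (x i) : ℝ)) - 1) ^ (p - 1) +
          (p - 1) * ((N : ℝ)⁻¹ * w (x k)) * W ^ (p - 2)) := mul_le_mul_of_nonneg_left h1 hwk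
      _ = (w (x k) : ℝ) *
        max 0 ((N : ℝ)⁻¹ * (∑ i ∈ Finset.univ.erase k, (w (x i) : ℝ)) - 1) ^ (p - 1) +
          (p - 1) / N * ((w (x k) : ℝ) * (w (x k) * W ^ (p - 2))) := by ring
      _ ≤ _ := by
        gcongr
        exact div_nonneg (by linarith) hN0.le
  have hconst : (N : ℝ)⁻¹ * ∑ _k : Fin N, W ^ p = W ^ p := by
    simp [hN0.ne']
  rw [hleft]
  calc W * max 0 (W - 1) ^ (p - 1)
      = (N : ℝ)⁻¹ * ∑ k, (w (x k) : ℝ) * max 0 (W - 1) ^ (p - 1) := by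
        rw [← Finset.sum_mul, ← mul_assoc]; rfl
    _ ≤ (N : ℝ)⁻¹ * ∑ k, ((w (x k) : ℝ) *
        max 0 ((N : ℝ)⁻¹ * (∑ i ∈ Finset.univ.erase k, (w (x i) : ℝ)) - 1) ^ (p - 1) +
          (p - 1) / N * ((w (x k) : ℝ) ^ p + W ^ p)) := by
        gcongr with k _
        exact hk k
    _ = (N : ℝ)⁻¹ * ∑ k, (w (x k) : ℝ) *
        max 0 ((N : ℝ)⁻¹ * (∑ i ∈ Finset.univ.erase k, (w (x i) : ℝ)) - 1) ^ (p - 1) +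
          (p - 1) / N * ((N : ℝ)⁻¹ * (∑ k, (w (x k) : ℝ) ^ p) + W ^ p) := by
        rw [Finset.sum_add_distrib, ← Finset.mul_sum, Finset.sum_add_distrib, mul_add]
        linear_combination (p - 1) / N * hconst
    _ ≤ _ := by
        have : (p - 1) / N * W ^ p ≤ (p - 1) / N * ((N : ℝ)⁻¹ * ∑ n, (w (x n) : ℝ) ^ p) :=
          mul_le_mul_of_nonneg_left hJ (div_nonneg (by linarith) hN0.le)
        have e : 2 * (p - 1) / N * ((N : ℝ)⁻¹ * ∑ n, (w (x n) : ℝ) ^ p) =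
          (p - 1) / N * ((N : ℝ)⁻¹ * ∑ n, (w (x n) : ℝ) ^ p) +
          (p - 1) / N * ((N : ℝ)⁻¹ * ∑ n, (w (x n) : ℝ) ^ p) := by ring
        rw [e, mul_add]
        linarith

variable [MeasurableSpace X]

theorem lintegral_average (q : Measure X) [IsProbabilityMeasure q] {f : X → ℝ}
    (hf : Measurable f) (hf0 : ∀ x, 0 ≤ f x) (hN : 1 ≤ N) :
    ∫⁻ x, ENNReal.ofReal ((N : ℝ)⁻¹ * ∑ n, f (x n)) ∂qBar q N =
      ∫⁻ y, ENNReal.ofReal (f y) ∂q := by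
  have h0 : (0 : ℝ) < N := by exact_mod_cast hN
  have h : ∀ x : Fin N → X, ENNReal.ofReal ((N : ℝ)⁻¹ * ∑ n, f (x n)) =
      (N : ℝ≥0∞)⁻¹ * ∑ n, ENNReal.ofReal (f (x n)) := fun x => by
    rw [ENNReal.ofReal_mul (by positivity), ENNReal.ofReal_inv_of_pos h0,
      ENNReal.ofReal_natCast, ENNReal.ofReal_sum_of_nonneg fun _ _ => hf0 _]
  simp_rw [h]
  rw [lintegral_const_mul _ (by fun_prop), lintegral_finsetSum _ (fun n _ => by fun_prop)]
  have : ∀ n : Fin N, ∫⁻ x, ENNReal.ofReal (f (x n)) ∂qBar q N =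
      ∫⁻ y, ENNReal.ofReal (f y) ∂q := fun n =>
    lintegral_eval q (f := fun y => ENNReal.ofReal (f y)) (by fun_prop) n
  simp only [this, Finset.sum_const, Finset.card_univ, Fintype.card_fin, nsmul_eq_mul]
  rw [← mul_assoc, ENNReal.inv_mul_cancel (by simp; omega) (by simp), one_mul]

/-- The `k`-th weight has mean one and is independent of the others. The remaining sum is still
divided by `N`, not `N - 1`, so it is dominated by the full average. -/
theorem lintegral_weight_mul_excess_erase {q : Measure X} [IsProbabilityMeasure q]
    {w : X → ℝ≥0} (hw : Measurable w) (h1 : ∫⁻ x, (w x : ℝ≥0∞) ∂q = 1) {p : ℝ} (hp : 2 ≤ p)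
    (k : Fin N) :
    ∫⁻ x, ENNReal.ofReal ((w (x k) : ℝ) *
        max 0 ((N : ℝ)⁻¹ * (∑ i ∈ Finset.univ.erase k, (w (x i) : ℝ)) - 1) ^ (p - 1)) ∂qBar q N ≤
      ∫⁻ x, ENNReal.ofReal (max 0 (Zhat w x - 1) ^ (p - 1)) ∂qBar q N := by
  have hind := iIndepFun_pi (ι := Fin N) (μ := fun _ => q) (X := fun _ y => (w y : ℝ))
    fun i => by fun_prop
  have hk := (hind.indepFun_finsetSum_of_notMem (fun i => by fun_prop)
    (Finset.notMem_erase k Finset.univ)).symm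
  have hφ : Measurable fun s : ℝ => ENNReal.ofReal (max 0 ((N : ℝ)⁻¹ * s - 1) ^ (p - 1)) := by
    fun_prop
  have hk' := hk.comp ENNReal.measurable_ofReal hφ
  have hmul := lintegral_mul_eq_lintegral_mul_lintegral_of_indepFun (by fun_prop) (by fun_prop) hk'
  have hwint : ∫⁻ x, ENNReal.ofReal (w (x k) : ℝ) ∂qBar q N = 1 := by
    simp_rw [ENNReal.ofReal_coe_nnreal]
    exact (lintegral_eval q (f := fun y => (w y : ℝ≥0∞)) (by fun_prop) k).trans h1
  calc _ = (∫⁻ x, ENNReal.ofReal (w (x k) : ℝ) ∂qBar q N) *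
        ∫⁻ x, ENNReal.ofReal (max 0 ((N : ℝ)⁻¹ *
          (∑ i ∈ Finset.univ.erase k, (w (x i) : ℝ)) - 1) ^ (p - 1)) ∂qBar q N := by
        simp_rw [ENNReal.ofReal_mul (NNReal.coe_nonneg _)]
        simpa [qBar, Function.comp_def, Finset.sum_apply] using hmul
    _ ≤ _ := by
        rw [hwint, one_mul]
        refine lintegral_mono fun x => ENNReal.ofReal_le_ofReal ?_
        refine Real.rpow_le_rpow (le_max_left _ _) (max_le_max le_rfl ?_) (by linarith)
        rw [Zhat]
        gcongr
        exact Finset.erase_subset _ _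

/-- The `p`-th moment of the excess of an average of `N` independent weights over their mean is
of order at most `1 / N`. -/
theorem lintegral_excess_rpow_le {q : Measure X} [IsProbabilityMeasure q]
    {w : X → ℝ≥0} (hw : Measurable w) (h1 : ∫⁻ x, (w x : ℝ≥0∞) ∂q = 1) {p : ℝ} (hp : 2 ≤ p)
    (hmom : ∫⁻ x, (w x : ℝ≥0∞) ^ p ∂q < ∞) (hN : 1 ≤ N) :
    ∫⁻ x, ENNReal.ofReal (max 0 (Zhat w x - 1) ^ p) ∂qBar q N ≤
      ENNReal.ofReal (2 * (p - 1) / N) * ∫⁻ x, (w x : ℝ≥0∞) ^ p ∂q := by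
  have hN0 : (0 : ℝ) < N := by exact_mod_cast hN
  have hZm := measurable_Zhat hw N
  have hpow : ∀ x, ENNReal.ofReal ((w x : ℝ) ^ p) = (w x : ℝ≥0∞) ^ p := fun x => by
    rw [← ENNReal.ofReal_rpow_of_nonneg (NNReal.coe_nonneg _) (by linarith),
      ENNReal.ofReal_coe_nnreal]
  have havg : ∫⁻ x, ENNReal.ofReal ((N : ℝ)⁻¹ * ∑ n, (w (x n) : ℝ) ^ p) ∂qBar q N =
      ∫⁻ x, (w x : ℝ≥0∞) ^ p ∂q := by
    rw [lintegral_average q (f := fun y => (w y : ℝ) ^ p) (by fun_prop)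
      (fun y => Real.rpow_nonneg (NNReal.coe_nonneg _) _) hN]
    simp_rw [hpow]
  set g : (Fin N → X) → ℝ := fun x => max 0 (Zhat w x - 1) ^ (p - 1) with hg
  have hg0 : ∀ x, 0 ≤ g x := fun x => Real.rpow_nonneg (le_max_left _ _) _
  have hgm : Measurable g := by fun_prop
  -- Finiteness is what permits cancelling this term from both sides of `key`.
  have hgfin : ∫⁻ x, ENNReal.ofReal (g x) ∂qBar q N ≠ ∞ := by
    have hb : ∀ x, g x ≤ 1 + (N : ℝ)⁻¹ * ∑ n, (w (x n) : ℝ) ^ p := fun x => by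
      refine le_trans ?_ (add_le_add le_rfl (Zhat_rpow_le w hN (by linarith) x))
      have hZ0 := Zhat_nonneg w x
      rcases le_total (Zhat w x) 1 with h | h
      · simp only [hg]
        rw [max_eq_left (by linarith), Real.zero_rpow (by linarith)]
        have := Real.rpow_nonneg hZ0 p
        linarith
      · simp only [hg]
        rw [max_eq_right (by linarith)]
        calc (Zhat w x - 1) ^ (p - 1) ≤ Zhat w x ^ (p - 1) :=
              Real.rpow_le_rpow (by linarith) (by linarith) (by linarith)
          _ ≤ Zhat w x ^ p := Real.rpow_le_rpow_of_exponent_le h (by linarith)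
          _ ≤ _ := by linarith
    have hlt : ∫⁻ x, ENNReal.ofReal (g x) ∂qBar q N ≤ 1 + ∫⁻ x, (w x : ℝ≥0∞) ^ p ∂q := by
      calc _ ≤ ∫⁻ x, (1 + ENNReal.ofReal ((N : ℝ)⁻¹ * ∑ n, (w (x n) : ℝ) ^ p)) ∂qBar q N := by
            refine lintegral_mono fun x => (ENNReal.ofReal_le_ofReal (hb x)).trans ?_
            rw [ENNReal.ofReal_add zero_le_one (mul_nonneg (by positivity)
              (Finset.sum_nonneg fun _ _ => Real.rpow_nonneg (NNReal.coe_nonneg _) _)),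
              ENNReal.ofReal_one]
        _ = _ := by
            rw [lintegral_add_left measurable_const, havg]
            simp
    exact (hlt.trans_lt (ENNReal.add_lt_top.2 ⟨ENNReal.one_lt_top, hmom⟩)).ne
  have key : ∫⁻ x, ENNReal.ofReal (g x) ∂qBar q N +
      ∫⁻ x, ENNReal.ofReal (max 0 (Zhat w x - 1) ^ p) ∂qBar q N ≤
      ∫⁻ x, ENNReal.ofReal (g x) ∂qBar q N +
      ENNReal.ofReal (2 * (p - 1) / N) * ∫⁻ x, (w x : ℝ≥0∞) ^ p ∂q := by
    have hterm0 : ∀ (x : Fin N → X) (k : Fin N), 0 ≤ (w (x k) : ℝ) *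
        max 0 ((N : ℝ)⁻¹ * (∑ i ∈ Finset.univ.erase k, (w (x i) : ℝ)) - 1) ^ (p - 1) :=
      fun x k => mul_nonneg (NNReal.coe_nonneg _) (Real.rpow_nonneg (le_max_left _ _) _)
    have hfirst : ∫⁻ x, ENNReal.ofReal ((N : ℝ)⁻¹ * ∑ k, (w (x k) : ℝ) *
        max 0 ((N : ℝ)⁻¹ * (∑ i ∈ Finset.univ.erase k, (w (x i) : ℝ)) - 1) ^ (p - 1)) ∂qBar q N ≤
        ∫⁻ x, ENNReal.ofReal (g x) ∂qBar q N := by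
      have h : ∀ x : Fin N → X, ENNReal.ofReal ((N : ℝ)⁻¹ * ∑ k, (w (x k) : ℝ) *
          max 0 ((N : ℝ)⁻¹ * (∑ i ∈ Finset.univ.erase k, (w (x i) : ℝ)) - 1) ^ (p - 1)) =
          (N : ℝ≥0∞)⁻¹ * ∑ k, ENNReal.ofReal ((w (x k) : ℝ) *
          max 0 ((N : ℝ)⁻¹ * (∑ i ∈ Finset.univ.erase k, (w (x i) : ℝ)) - 1) ^ (p - 1)) :=
        fun x => by
          rw [ENNReal.ofReal_mul (by positivity), ENNReal.ofReal_inv_of_pos hN0,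
            ENNReal.ofReal_natCast, ENNReal.ofReal_sum_of_nonneg fun k _ => hterm0 x k]
      simp_rw [h]
      rw [lintegral_const_mul _ (by fun_prop), lintegral_finsetSum _ (fun n _ => by fun_prop)]
      calc _ ≤ (N : ℝ≥0∞)⁻¹ * ∑ _k : Fin N, ∫⁻ x, ENNReal.ofReal (g x) ∂qBar q N := by
            exact mul_le_mul_right (Finset.sum_le_sum fun k _ =>
              lintegral_weight_mul_excess_erase hw h1 hp k) _
        _ = _ := by
            simp only [Finset.sum_const, Finset.card_univ, Fintype.card_fin, nsmul_eq_mul]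
            rw [← mul_assoc, ENNReal.inv_mul_cancel (by simp; omega) (by simp), one_mul]
    calc _ = ∫⁻ x, ENNReal.ofReal (g x + max 0 (Zhat w x - 1) ^ p) ∂qBar q N := by
          rw [← lintegral_add_left (by fun_prop)]
          congr 1 with x
          rw [ENNReal.ofReal_add (hg0 x) (Real.rpow_nonneg (le_max_left _ _) _)]
      _ ≤ ∫⁻ x, (ENNReal.ofReal ((N : ℝ)⁻¹ * ∑ k, (w (x k) : ℝ) *
            max 0 ((N : ℝ)⁻¹ * (∑ i ∈ Finset.univ.erase k, (w (x i) : ℝ)) - 1) ^ (p - 1)) +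
          ENNReal.ofReal (2 * (p - 1) / N) *
            ENNReal.ofReal ((N : ℝ)⁻¹ * ∑ n, (w (x n) : ℝ) ^ p)) ∂qBar q N := by
          refine lintegral_mono fun x => ?_
          rw [← ENNReal.ofReal_mul (div_nonneg (by linarith) hN0.le)]
          refine (ENNReal.ofReal_le_ofReal (excess_rpow_add_excess_rpow_le w hN hp x)).trans ?_
          exact ENNReal.ofReal_add_le
      _ = _ := by
          rw [lintegral_add_left (by fun_prop), lintegral_const_mul _ (by fun_prop), havg]
      _ ≤ _ := by gcongr
  exact (ENNReal.add_le_add_iff_left hgfin).1 key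

end Moments

/-! ### Polynomial rate in `t`, uniform in `N` -/

section Rate

/-- Geometric decay `exp (-c t / M)` traded for a power of `M / (1 + t)`. -/
theorem pow_le_rpow_div {s c : ℝ} (hs : 0 < s) (hc : 0 < c) (hc1 : c ≤ 1) {M r : ℝ}
    (hM : 1 ≤ M) (hr : 0 ≤ r) (hrM : r ≤ 1 - c / M) (t : ℕ) :
    r ^ t ≤ Real.exp 1 * (s / c) ^ s * (M / (1 + t)) ^ s := by
  have hM0 : 0 < M := by linarith
  have ht : (0 : ℝ) < 1 + t := by positivity
  set u := c * (1 + t) / M with hu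
  have hu0 : 0 < u := by positivity
  -- Passing from `t` to `1 + t` in the exponent costs `c / M ≤ 1`, hence the factor `e`.
  have h1 : r ^ t ≤ Real.exp 1 * Real.exp (-u) := by
    calc r ^ t ≤ Real.exp (-(c / M)) ^ t := by
          refine pow_le_pow_left₀ hr (hrM.trans ?_) t
          have := Real.add_one_le_exp (-(c / M))
          linarith
      _ = Real.exp (c / M - u) := by
          rw [← Real.exp_nat_mul, hu]
          congr 1
          field_simp
          ring
      _ ≤ Real.exp (1 - u) := by
          refine Real.exp_le_exp.2 (sub_le_sub_right ?_ _)
          rw [div_le_one hM0]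
          linarith
      _ = _ := by rw [sub_eq_add_neg, Real.exp_add]
  have h2 : (u / s) ^ s ≤ Real.exp u := by
    calc (u / s) ^ s ≤ Real.exp (u / s) ^ s := by
          refine Real.rpow_le_rpow (by positivity) ?_ hs.le
          have := Real.add_one_le_exp (u / s)
          linarith
      _ = Real.exp u := by rw [← Real.exp_mul, div_mul_cancel₀ _ hs.ne']
  have h3 : Real.exp (-u) ≤ (s / c) ^ s * (M / (1 + t)) ^ s := by
    rw [← Real.mul_rpow (by positivity) (by positivity)]
    have : s / c * (M / (1 + t)) = (u / s)⁻¹ := by rw [hu]; field_simp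
    rw [this, Real.inv_rpow (by positivity), Real.exp_neg]
    exact inv_anti₀ (Real.rpow_pos_of_pos (by positivity) _) h2
  calc _ ≤ _ := h1
    _ ≤ Real.exp 1 * ((s / c) ^ s * (M / (1 + t)) ^ s) := by gcongr
    _ = _ := by ring

/-- The threshold `2` works because `W ≤ 2 * (W - 1)` beyond it, while below it the factor `r` is
kept. -/
theorem mul_max_two_rpow_le {p W r : ℝ} (hp : 1 ≤ p) (hW : 0 ≤ W) (hr : 0 ≤ r) (hr1 : r ≤ 1) :
    W * r * max W 2 ^ (p - 1) ≤ 2 ^ (p - 1) * (W * r) + 2 ^ p * max 0 (W - 1) ^ p := by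
  rcases le_or_gt W 2 with h | h
  · rw [max_eq_right h, mul_comm]
    have : 0 ≤ (2 : ℝ) ^ p * max 0 (W - 1) ^ p :=
      mul_nonneg (by positivity) (Real.rpow_nonneg (le_max_left _ _) _)
    linarith
  · rw [max_eq_left h.le, max_eq_right (by linarith)]
    have h1 : W * r * W ^ (p - 1) ≤ W ^ p := by
      calc W * r * W ^ (p - 1) ≤ W * 1 * W ^ (p - 1) := by gcongr
        _ = W ^ p := by
          rw [mul_one, mul_comm, ← Real.rpow_add_one (by linarith)]; congr 1; ring
    have h2 : W ^ p ≤ 2 ^ p * (W - 1) ^ p := by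
      rw [← Real.mul_rpow (by norm_num) (by linarith)]
      exact Real.rpow_le_rpow hW (by linarith) (by linarith)
    have h3 : 0 ≤ (2 : ℝ) ^ (p - 1) * (W * r) := by positivity
    linarith

variable {X : Type*} {N : ℕ}

theorem average_min_one_le (w : X → ℝ≥0) (hN : 1 ≤ N) (x : Fin N → X) :
    (N : ℝ)⁻¹ * ∑ n, min 1 (w (x n) : ℝ) ≤ min 1 (Zhat w x) := by
  have h0 : (N : ℝ) ≠ 0 := by positivity
  refine le_min ?_ ?_
  · calc (N : ℝ)⁻¹ * ∑ n, min 1 (w (x n) : ℝ) ≤ (N : ℝ)⁻¹ * ∑ _n : Fin N, 1 := by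
          gcongr; exact min_le_left _ _
      _ = 1 := by simp [h0]
  · rw [Zhat]
    gcongr
    exact min_le_right _ _

theorem average_min_one_div_le_accept {w : X → ℝ≥0} (hN : 1 ≤ N) {x : Fin N → X}
    (hx : 0 < Zhat w x) {M : ℝ} (hM : 1 ≤ M) (hxM : Zhat w x ≤ M) (y : Fin N → X) :
    ((N : ℝ)⁻¹ * ∑ n, min 1 (w (y n) : ℝ)) / M ≤ accept w x y := by
  have hM0 : 0 < M := by linarith
  have hm0 : 0 ≤ min 1 (Zhat w y) := le_min zero_le_one (Zhat_nonneg w y)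
  refine (div_le_div_of_nonneg_right (average_min_one_le w hN y) hM0.le).trans (le_min ?_ ?_)
  · rw [div_le_one hM0]
    exact (min_le_left _ _).trans hM
  · exact div_le_div₀ (Zhat_nonneg w y) (min_le_right _ _) hx hxM

variable [MeasurableSpace X]

theorem integral_average (q : Measure X) [IsProbabilityMeasure q] {f : X → ℝ}
    (hf : Measurable f) (hf0 : ∀ x, 0 ≤ f x) (hN : 1 ≤ N) :
    ∫ x, (N : ℝ)⁻¹ * ∑ n, f (x n) ∂qBar q N = ∫ y, f y ∂q := by
  rw [integral_eq_lintegral_of_nonneg_ae (.of_forall fun x => ?_)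
    (Measurable.aestronglyMeasurable (by fun_prop)), lintegral_average q hf hf0 hN,
    integral_eq_lintegral_of_nonneg_ae (.of_forall hf0) hf.aestronglyMeasurable]
  exact mul_nonneg (by positivity) (Finset.sum_nonneg fun _ _ => hf0 _)

/-- Truncating each weight at one bounds the acceptance probability below by an average over
particles, whose mean does not depend on `N`. -/
theorem integral_min_one_div_le_one_sub_hold {q : Measure X} [IsProbabilityMeasure q]
    {w : X → ℝ≥0} (hw : Measurable w) (hN : 1 ≤ N) {x : Fin N → X} (hx : 0 < Zhat w x) {M : ℝ}
    (hM : 1 ≤ M) (hxM : Zhat w x ≤ M) :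
    (∫ y, min 1 (w y : ℝ) ∂q) / M ≤ 1 - hold q w x := by
  have hacc : Integrable (accept w x) (qBar q N) :=
    .of_bound (measurable_accept_right hw x).aestronglyMeasurable 1 (.of_forall fun y => by
      rw [Real.norm_of_nonneg (accept_nonneg w x y)]; exact accept_le_one w x y)
  have h0 : ∀ y : Fin N → X, 0 ≤ (N : ℝ)⁻¹ * ∑ n, min 1 (w (y n) : ℝ) := fun y =>
    mul_nonneg (by positivity) (Finset.sum_nonneg fun _ _ => le_min zero_le_one (NNReal.coe_nonneg _))
  have h1 : 1 - hold q w x = ∫ y, accept w x y ∂qBar q N := by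
    rw [hold_eq_integral q hw, integral_sub (integrable_const _) hacc]
    simp
  rw [h1, ← integral_average q (f := fun y => min 1 (w y : ℝ)) (by fun_prop)
    (fun y => le_min zero_le_one (NNReal.coe_nonneg _)) hN, ← integral_div]
  exact integral_mono_of_nonneg (.of_forall fun y => div_nonneg (h0 y) (by linarith)) hacc
    (.of_forall fun y => average_min_one_div_le_accept hN hx hM hxM y)

theorem integrable_min_one (q : Measure X) [IsProbabilityMeasure q] {w : X → ℝ≥0}
    (hw : Measurable w) : Integrable (fun y => min 1 (w y : ℝ)) q :=
  .of_bound (Measurable.aestronglyMeasurable (by fun_prop)) 1 (.of_forall fun y => by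
    rw [Real.norm_of_nonneg (le_min zero_le_one (NNReal.coe_nonneg _))]; exact min_le_left _ _)

theorem integral_min_one_pos {q : Measure X} [IsProbabilityMeasure q] {w : X → ℝ≥0}
    (hw : Measurable w) (hpos : ∀ᵐ x ∂q, 0 < w x) : 0 < ∫ y, min 1 (w y : ℝ) ∂q := by
  have h0 : ∀ y, 0 ≤ min 1 (w y : ℝ) := fun y => le_min zero_le_one (NNReal.coe_nonneg _)
  refine lt_of_le_of_ne (integral_nonneg h0) fun h => ?_
  have hz := (integral_eq_zero_iff_of_nonneg h0 (integrable_min_one q hw)).1 h.symm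
  obtain ⟨y, hy1, hy2⟩ := (hz.and hpos).exists
  exact (lt_min zero_lt_one (NNReal.coe_pos.2 hy2)).ne' hy1

theorem integral_min_one_le_one {q : Measure X} [IsProbabilityMeasure q] {w : X → ℝ≥0}
    (hw : Measurable w) : ∫ y, min 1 (w y : ℝ) ∂q ≤ 1 := by
  calc _ ≤ ∫ _y, (1 : ℝ) ∂q :=
        integral_mono (integrable_min_one q hw) (integrable_const _) fun y => min_le_left _ _
    _ = 1 := by simp

theorem integrable_excess_rpow {q : Measure X} [IsProbabilityMeasure q]
    {w : X → ℝ≥0} (hw : Measurable w) (h1 : ∫⁻ x, (w x : ℝ≥0∞) ∂q = 1) {p : ℝ} (hp : 2 ≤ p)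
    (hmom : ∫⁻ x, (w x : ℝ≥0∞) ^ p ∂q < ∞) (hN : 1 ≤ N) :
    Integrable (fun x : Fin N → X => max 0 (Zhat w x - 1) ^ p) (qBar q N) := by
  have hZm := measurable_Zhat hw N
  refine ⟨Measurable.aestronglyMeasurable (by fun_prop), ?_⟩
  rw [hasFiniteIntegral_iff_ofReal (.of_forall fun x => Real.rpow_nonneg (le_max_left _ _) _)]
  exact (lintegral_excess_rpow_le hw h1 hp hmom hN).trans_lt
    (ENNReal.mul_lt_top ENNReal.ofReal_lt_top hmom)

theorem integral_excess_rpow_le {q : Measure X} [IsProbabilityMeasure q]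
    {w : X → ℝ≥0} (hw : Measurable w) (h1 : ∫⁻ x, (w x : ℝ≥0∞) ∂q = 1) {p : ℝ} (hp : 2 ≤ p)
    (hmom : ∫⁻ x, (w x : ℝ≥0∞) ^ p ∂q < ∞) (hN : 1 ≤ N) :
    ∫ x, max 0 (Zhat w x - 1) ^ p ∂qBar q N ≤
      2 * (p - 1) * (∫⁻ x, (w x : ℝ≥0∞) ^ p ∂q).toReal / N := by
  have hN0 : (0 : ℝ) < N := by exact_mod_cast hN
  rw [integral_eq_lintegral_of_nonneg_ae
    (.of_forall fun x => Real.rpow_nonneg (le_max_left _ _) _)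
    (integrable_excess_rpow hw h1 hp hmom hN).aestronglyMeasurable]
  have h := ENNReal.toReal_mono (ENNReal.mul_lt_top ENNReal.ofReal_lt_top hmom).ne
    (lintegral_excess_rpow_le hw h1 hp hmom hN)
  rw [ENNReal.toReal_mul, ENNReal.toReal_ofReal (div_nonneg (by linarith) hN0.le)] at h
  refine h.trans (le_of_eq ?_)
  ring

theorem lintegral_rpow_two_lt_top {q : Measure X} [IsProbabilityMeasure q]
    {w : X → ℝ≥0} {p : ℝ} (hp : 2 ≤ p)
    (hmom : ∫⁻ x, (w x : ℝ≥0∞) ^ p ∂q < ∞) : ∫⁻ x, (w x : ℝ≥0∞) ^ (2 : ℝ) ∂q < ∞ := by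
  calc _ ≤ ∫⁻ x, (1 + (w x : ℝ≥0∞) ^ p) ∂q := by
        refine lintegral_mono fun x => ?_
        rcases le_total (w x : ℝ≥0∞) 1 with h | h
        · exact (ENNReal.rpow_le_one h (by norm_num)).trans le_self_add
        · exact (ENNReal.rpow_le_rpow_of_exponent_le h hp).trans le_add_self
    _ = 1 + ∫⁻ x, (w x : ℝ≥0∞) ^ p ∂q := by
        rw [lintegral_add_left measurable_const]; simp
    _ < ∞ := ENNReal.add_lt_top.2 ⟨ENNReal.one_lt_top, hmom⟩

theorem integrable_excess {q : Measure X} [IsProbabilityMeasure q]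
    {w : X → ℝ≥0} (hw : Measurable w) (h1 : ∫⁻ x, (w x : ℝ≥0∞) ∂q = 1) (hN : 1 ≤ N) :
    Integrable (fun x : Fin N → X => max 0 (Zhat w x - 1)) (qBar q N) :=
  ((integrable_Zhat hw h1 hN).sub (integrable_const (1 : ℝ))).pos_part.congr
    (.of_forall fun z => by simp [max_comm])

theorem integral_excess_le {q : Measure X} [IsProbabilityMeasure q]
    {w : X → ℝ≥0} (hw : Measurable w) (h1 : ∫⁻ x, (w x : ℝ≥0∞) ∂q = 1)
    (hmom : ∫⁻ x, (w x : ℝ≥0∞) ^ (2 : ℝ) ∂q < ∞) (hN : 1 ≤ N) :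
    ∫ x, max 0 (Zhat w x - 1) ∂qBar q N ≤
      (1 + 2 * (∫⁻ x, (w x : ℝ≥0∞) ^ (2 : ℝ) ∂q).toReal) / (2 * √N) := by
  have hN0 : (0 : ℝ) < N := by exact_mod_cast hN
  have hs : 0 < √(N : ℝ) := Real.sqrt_pos.2 hN0
  have hss : √(N : ℝ) * √(N : ℝ) = N := Real.mul_self_sqrt hN0.le
  have h2 := integral_excess_rpow_le hw h1 le_rfl hmom hN
  have hi2 := integrable_excess_rpow hw h1 le_rfl hmom hN
  set m := (∫⁻ x, (w x : ℝ≥0∞) ^ (2 : ℝ) ∂q).toReal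
  calc _ ≤ ∫ x, (1 / (2 * √N) + √N / 2 * max 0 (Zhat w x - 1) ^ (2 : ℝ)) ∂qBar q N := by
        refine integral_mono (integrable_excess hw h1 hN)
          ((integrable_const _).add (hi2.const_mul _)) fun x => ?_
        simp only [Real.rpow_two]
        set f := max 0 (Zhat w x - 1)
        -- Young's inequality, balanced for a second moment of order `1 / N`.
        have h : 1 / (2 * √(N : ℝ)) + √N / 2 * f ^ 2 - f = (√N * f - 1) ^ 2 / (2 * √N) := by
          field_simp; ring
        have : 0 ≤ (√(N : ℝ) * f - 1) ^ 2 / (2 * √N) := by positivity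
        linarith
    _ = 1 / (2 * √N) + √N / 2 * ∫ x, max 0 (Zhat w x - 1) ^ (2 : ℝ) ∂qBar q N := by
        rw [integral_add (integrable_const _) (hi2.const_mul _), integral_const_mul]
        simp
    _ ≤ 1 / (2 * √N) + √N / 2 * (2 * (2 - 1) * m / N) := by gcongr
    _ = _ := by
        rw [← hss]
        field_simp
        norm_num
        ring

/-- Compare both weights with one: `(a - b)₊ ≤ (a - 1)₊ + (1 - b)₊`. Since the mean weight is one,
the two positive parts have equal integrals. -/
theorem integral_Zhat_mul_hold_le {q : Measure X} [IsProbabilityMeasure q]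
    {w : X → ℝ≥0} (hw : Measurable w) (h1 : ∫⁻ x, (w x : ℝ≥0∞) ∂q = 1) (hN : 1 ≤ N) :
    ∫ x, Zhat w x * hold q w x ∂qBar q N ≤ 2 * ∫ x, max 0 (Zhat w x - 1) ∂qBar q N := by
  have hZ := integrable_Zhat hw h1 hN
  have hZm := measurable_Zhat hw N
  have hi := integrable_excess hw h1 hN
  have hid : ∀ y : Fin N → X, max 0 (1 - Zhat w y) = max 0 (Zhat w y - 1) + (1 - Zhat w y) := by
    intro y
    rcases le_total (Zhat w y) 1 with h | h
    · rw [max_eq_right (by linarith), max_eq_left (by linarith)]; ring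
    · rw [max_eq_left (by linarith), max_eq_right (by linarith)]; ring
  have hsub : Integrable (fun y : Fin N → X => 1 - Zhat w y) (qBar q N) :=
    (integrable_const (1 : ℝ)).sub hZ
  have hj : Integrable (fun y : Fin N → X => max 0 (1 - Zhat w y)) (qBar q N) :=
    (hi.add hsub).congr (.of_forall fun y => (hid y).symm)
  have hjint : ∫ y, max 0 (1 - Zhat w y) ∂qBar q N = ∫ x, max 0 (Zhat w x - 1) ∂qBar q N := by
    simp_rw [hid]
    rw [integral_add hi hsub, integral_sub (integrable_const _) hZ, integral_Zhat hw h1 hN]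
    simp
  have hpt : ∀ x : Fin N → X, Zhat w x * hold q w x ≤
      max 0 (Zhat w x - 1) + ∫ x, max 0 (Zhat w x - 1) ∂qBar q N := by
    intro x
    rw [Zhat_mul_hold q hw]
    calc _ ≤ ∫ y, (max 0 (Zhat w x - 1) + max 0 (1 - Zhat w y)) ∂qBar q N := by
          refine integral_mono_of_nonneg (.of_forall fun y => le_max_left _ _)
            ((integrable_const _).add hj) (.of_forall fun y => ?_)
          have a1 := le_max_left 0 (Zhat w x - 1)
          have a2 := le_max_right 0 (Zhat w x - 1)
          have a3 := le_max_left 0 (1 - Zhat w y)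
          have a4 := le_max_right 0 (1 - Zhat w y)
          exact max_le (by linarith) (by linarith)
      _ = _ := by
          rw [integral_add (integrable_const _) hj, hjint]
          simp
  calc _ ≤ ∫ x, (max 0 (Zhat w x - 1) + ∫ x, max 0 (Zhat w x - 1) ∂qBar q N) ∂qBar q N :=
        integral_mono_of_nonneg
          (.of_forall fun x => mul_nonneg (Zhat_nonneg w x) (hold_nonneg q w x))
          (hi.add (integrable_const _)) (.of_forall hpt)
    _ = _ := by
        rw [integral_add hi (integrable_const _)]
        simp
        ring

/-- Of the `t + 1` factors `hold`, `t` yield the decay in `t`; the one left over makes `∫ Zhat *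
hold` of order `1 / √N`. -/
theorem integral_Zhat_mul_hold_pow_le {q : Measure X} [IsProbabilityMeasure q]
    {w : X → ℝ≥0} (hw : Measurable w) (h1 : ∫⁻ x, (w x : ℝ≥0∞) ∂q = 1)
    (hpos : ∀ᵐ x ∂q, 0 < w x) {p : ℝ} (hp : 2 ≤ p) (hmom : ∫⁻ x, (w x : ℝ≥0∞) ^ p ∂q < ∞) :
    ∃ C : ℝ, ∀ N : ℕ, 1 ≤ N → ∀ t : ℕ,
      ∫ x, Zhat w x * hold q w x ^ (t + 1) ∂qBar q N ≤ C / (√N * (1 + (t : ℝ)) ^ (p - 1)) := by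
  have hmom2 := lintegral_rpow_two_lt_top hp hmom
  set c := ∫ y, min 1 (w y : ℝ) ∂q with hc
  have hc0 : 0 < c := integral_min_one_pos hw hpos
  have hc1 : c ≤ 1 := integral_min_one_le_one hw
  set m2 := (∫⁻ x, (w x : ℝ≥0∞) ^ (2 : ℝ) ∂q).toReal with hm2
  set m := (∫⁻ x, (w x : ℝ≥0∞) ^ p ∂q).toReal with hm
  set D := Real.exp 1 * ((p - 1) / c) ^ (p - 1) with hD
  have hD0 : 0 ≤ D := mul_nonneg (Real.exp_pos _).le
    (Real.rpow_nonneg (div_nonneg (by linarith) hc0.le) _)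
  refine ⟨D * (2 ^ (p - 1) * (1 + 2 * m2) + 2 ^ p * (2 * (p - 1) * m)), fun N hN t => ?_⟩
  have hN0 : (0 : ℝ) < N := by exact_mod_cast hN
  have hs : 0 < √(N : ℝ) := Real.sqrt_pos.2 hN0
  have hT : (0 : ℝ) < (1 + (t : ℝ)) ^ (p - 1) := Real.rpow_pos_of_pos (by positivity) _
  have hip := integrable_excess_rpow hw h1 hp hmom hN
  have hiW : Integrable (fun x : Fin N → X => Zhat w x * hold q w x) (qBar q N) := by
    simpa using integrable_Zhat_mul_hold_pow (N := N) hw h1 hN 1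
  -- The available order `1 / N` is weakened to `1 / √N` to match the other term.
  have hexc : ∫ x, max 0 (Zhat w x - 1) ^ p ∂qBar q N ≤ 2 * (p - 1) * m / √N := by
    refine (integral_excess_rpow_le hw h1 hp hmom hN).trans ?_
    have hm0 : 0 ≤ m := ENNReal.toReal_nonneg
    refine div_le_div_of_nonneg_left (mul_nonneg (by linarith) hm0) hs ?_
    rw [Real.sqrt_le_left hN0.le]
    have : (1 : ℝ) ≤ N := by exact_mod_cast hN
    nlinarith
  have hWr : ∫ x, Zhat w x * hold q w x ∂qBar q N ≤ (1 + 2 * m2) / √N := by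
    refine (integral_Zhat_mul_hold_le hw h1 hN).trans ?_
    have := integral_excess_le hw h1 hmom2 hN
    calc _ ≤ 2 * ((1 + 2 * m2) / (2 * √N)) := by gcongr
      _ = _ := by field_simp
  calc ∫ x, Zhat w x * hold q w x ^ (t + 1) ∂qBar q N
      ≤ ∫ x, D / (1 + (t : ℝ)) ^ (p - 1) * (2 ^ (p - 1) * (Zhat w x * hold q w x) +
          2 ^ p * max 0 (Zhat w x - 1) ^ p) ∂qBar q N := by
        refine integral_mono_ae (integrable_Zhat_mul_hold_pow hw h1 hN _)
          (((hiW.const_mul _).add (hip.const_mul _)).const_mul _) ?_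
        filter_upwards [ae_Zhat_pos hpos hN] with x hx
        have hM1 : (1 : ℝ) ≤ max (Zhat w x) 2 := le_max_of_le_right (by norm_num)
        have hacc := integral_min_one_div_le_one_sub_hold (q := q) hw hN hx hM1 (le_max_left _ _)
        have hr0 := hold_nonneg q w x
        have hpow := pow_le_rpow_div (s := p - 1) (by linarith) hc0 hc1 hM1 hr0
          (by linarith) t
        have hmax := mul_max_two_rpow_le (p := p) (by linarith) hx.le hr0 (hold_le_one q w x)
        rw [Real.div_rpow (show 0 ≤ max (Zhat w x) 2 by linarith) (by positivity)] at hpow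
        calc Zhat w x * hold q w x ^ (t + 1) = Zhat w x * hold q w x * hold q w x ^ t := by
              rw [pow_succ]; ring
          _ ≤ Zhat w x * hold q w x *
              (D * (max (Zhat w x) 2 ^ (p - 1) / (1 + (t : ℝ)) ^ (p - 1))) :=
              mul_le_mul_of_nonneg_left hpow (mul_nonneg hx.le hr0)
          _ = D / (1 + (t : ℝ)) ^ (p - 1) *
              (Zhat w x * hold q w x * max (Zhat w x) 2 ^ (p - 1)) := by ring
          _ ≤ _ := mul_le_mul_of_nonneg_left hmax (div_nonneg hD0 hT.le)
    _ = D / (1 + (t : ℝ)) ^ (p - 1) * (2 ^ (p - 1) * ∫ x, Zhat w x * hold q w x ∂qBar q N +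
          2 ^ p * ∫ x, max 0 (Zhat w x - 1) ^ p ∂qBar q N) := by
        rw [integral_const_mul, integral_add (hiW.const_mul _) (hip.const_mul _),
          integral_const_mul, integral_const_mul]
    _ ≤ D / (1 + (t : ℝ)) ^ (p - 1) * (2 ^ (p - 1) * ((1 + 2 * m2) / √N) +
          2 ^ p * (2 * (p - 1) * m / √N)) := by gcongr
    _ = _ := by field_simp

end Rate

end PIMH

end

theorem mainTheorem2 {X : Type*} [MeasurableSpace X] [MeasurableEq X]
    (q π : Measure X) [IsProbabilityMeasure q] [IsProbabilityMeasure π]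
    (w : X → ℝ≥0) (hw : Measurable w)
    (hac : π ≪ q) (hwπ : (fun x => (w x : ℝ≥0∞)) =ᵐ[q] π.rnDeriv q)
    (hpos : ∀ᵐ x ∂q, 0 < w x)
    (p : ℝ) (hp : 2 ≤ p) (hmom : ∫⁻ x, (w x : ℝ≥0∞) ^ p ∂q < ∞) :
    (∀ N : ℕ, 1 ≤ N → ∀ t : ℕ,
      ENNReal.ofReal
          (PIMH.tvDist ((PIMH.kernel q w N ^ t : Kernel (Fin N → X) (Fin N → X)) ∘ₘ PIMH.qBar q N) (PIMH.piBar q π N)) ≤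
        ∫⁻ s, max 0 ((PIMH.meetingTime w s : ℝ≥0∞) - 1 - (t : ℝ≥0∞)) ∂PIMH.sampleLaw q N) ∧
    ∃ C : ℝ, ∀ N : ℕ, 1 ≤ N → ∀ t : ℕ,
      PIMH.tvDist ((PIMH.kernel q w N ^ t : Kernel (Fin N → X) (Fin N → X)) ∘ₘ PIMH.qBar q N) (PIMH.piBar q π N) ≤
        C / (Real.sqrt N * (1 + (t : ℝ)) ^ (p - 1)) := by
  refine ⟨fun N hN t => PIMH.tvDist_le_lintegral_meetingTime hw hac hwπ hpos hN t, ?_⟩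
  obtain ⟨C, hC⟩ := PIMH.integral_Zhat_mul_hold_pow_le hw
    (PIMH.lintegral_weight_eq_one hac hwπ) hpos hp hmom
  exact ⟨C, fun N hN t =>
    (PIMH.tvDist_le_integral_hold_pow hw hac hwπ hpos hN t).trans (hC N hN t)⟩
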